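/- A ranked alphabet is a finite set of letters together with a finite set $\mathrm{ar}(a)$ (the arity) for each letter $a$. Fix a ranked alphabet $\mathbf\Gamma$. For ranked alphabets $\mathbf R=(R,\mathrm{ar})$, $\mathbf S=(S,\mathrm{ar})$ write $\mathbf R\otimes\mathbf S$ for their disjoint union; for $X\subseteq R$ let $\mathbf R|_X$ be the restriction, and for a finite set $B$ let $\mathcal O(B)$ be the alphabet whose letters are the elements of $B$, all of empty arity. Let $\mathrm{LTree}_{\mathbf\Gamma}(\mathbf R)$ be the set of trees over $\mathbf\Gamma\otimes\mathbf R$ in which every letter of $\mathbf R$ labels exactly one node. *The category $\mathcal R$ (Register).* Its objects are the ranked alphabets. A morphism $\mathbf R\to\mathbf S$ is a partial function $f:R\rightharpoonup S$ together with, for each $s\in S$, a tree $t_s\in \mathrm{LTree}_{\mathbf\Gamma}(\mathbf R|_{f^{-1}(s)}\otimes\mathcal O(\mathrm{ar}(s)))$. The identity has $f=\mathrm{id}$ and $t_r=r((b)_{b\in \mathrm{ar}(r)})$. Composition composes the partial functions and substitutes trees: the composite of $(f,(t_s)_s):\mathbf R\to\mathbf S$ with $(g,(w_q)_q):\mathbf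 S\to\mathbf Q$ has at $q$ the tree obtained from $w_q$ by recursively replacing each node labelled $s\in S$, with immediate subtrees $(c_b)_{b\in \mathrm{ar}(s)}$, by $t_s$ with the leaf $b$ replaced by the result for $c_b$. Disjoint union of alphabets, with the evident action on morphisms and the evident structural isomorphisms, is a symmetric monoidal structure on $\mathcal R$ whose unit is the empty alphabet. *Completions.* For a category $\mathcal C$, the free finite coproduct completion $\mathcal C_\oplus$ has as objects finite families $\bigoplus_{u\in U}C_u$ of objects of $\mathcal C$, with $\mathrm{Hom}(\bigoplus_u C_u,\bigoplus_v D_v)=\prod_u\sum_v\mathrm{Hom}_{\mathcal C}(C_u,D_v)$; let $\iota_\oplus(C)$ denote the one-element family $C$. The category $\mathcal C_{\oplus\&}$ has as objects the finite families of finite families $\bigoplus_{u\in U}\,\&_{x\in X_u}\,C_{u,x}$ (formal sums of formal products), with $$\mathrm{Hom}\Big(\bigoplus_u \&_x C_{u,x},\ \bigoplus_v \&_y D_{v,y}\Big)=\prod_{u}\sum_{v}\prod_{y\in Y_v}\sum_{x\in X_u}\mathrm{Hom}_{\mathcal C}(C_{u,x},D_{v,y})$$ and the evident identities and composition. A symmetric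 monoidal structure on $\mathcal C$ is lifted by $$\Big(\bigoplus_u C_u\Big)\otimes\Big(\bigoplus_v D_v\Big)=\bigoplus_{(u,v)}C_u\otimes D_v,\qquad \Big(\bigoplus_u \&_x C_{u,x}\Big)\otimes\Big(\bigoplus_v \&_y D_{v,y}\Big)=\bigoplus_{(u,v)}\ \&_{(x,y)}\ C_{u,x}\otimes D_{v,y},$$ the unit being the one-element family consisting of the unit of $\mathcal C$ and the structural isomorphisms being taken componentwise. **Theorem.** For every ranked alphabet $\mathbf\Gamma$: 1. for all objects $\mathbf R,\mathbf S$ of $\mathcal R$ there is an internal hom $\iota_\oplus(\mathbf R)\multimap\iota_\oplus(\mathbf S)$ in $\mathcal R_\oplus$, i.e. an object $H$ and a morphism $\mathrm{ev}:H\otimes\iota_\oplus(\mathbf R)\to\iota_\oplus(\mathbf S)$ such that for every object $X$ and every $h:X\otimes\iota_\oplus(\mathbf R)\to\iota_\oplus(\mathbf S)$ there is a unique $k:X\to H$ with $\mathrm{ev}\circ(k\otimes\mathrm{id})=h$; 2. the category $\mathcal R_{\oplus\&}$ has all finite products and all finite coproducts, and the lifted monoidal structure on $\mathcal R_{\oplus\&}$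 is symmetric and closed. -/

import Mathlib

open CategoryTheory CategoryTheory.MonoidalCategory CategoryTheory.Limits

universe v u

/-! ### Ranked alphabets and trees with holes -/

/-- A ranked alphabet: a finite set of letters, each with a finite set as its arity. -/
structure RankedAlphabet : Type 1 where
  letters : Type
  arity : letters → Type
  [fintypeLetters : Fintype letters]
  [fintypeArity : ∀ a, Fintype (arity a)]

attribute [instance] RankedAlphabet.fintypeLetters RankedAlphabet.fintypeArity

namespace RankedAlphabet

/-- The disjoint union `R ⊗ S = (R + S, [ar, ar])` of two ranked alphabets. -/
def tensor (R S : RankedAlphabet) : RankedAlphabet where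
  letters := R.letters ⊕ S.letters
  arity := Sum.elim R.arity S.arity
  fintypeArity := fun a => match a with
    | .inl r => R.fintypeArity r
    | .inr s => S.fintypeArity s

/-- The ranked alphabet without letters. -/
def empty : RankedAlphabet where
  letters := Empty
  arity := Empty.elim
  fintypeArity := fun a => a.elim

end RankedAlphabet

/-- Trees over the joint ranked alphabet `Γ ⊗ R ⊗ O(B)`, where `O(B)` consists of the elements of
`B` as letters of empty arity: a node is labelled by a letter of `Γ` (`out`), by a letter of `R`
(`reg`), or it is a leaf labelled by an element of `B` (`hole`). -/
inductive HoleTree (Γ R : RankedAlphabet) (B : Type) : Type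
  | out (b : Γ.letters) (c : Γ.arity b → HoleTree Γ R B) : HoleTree Γ R B
  | reg (r : R.letters) (c : R.arity r → HoleTree Γ R B) : HoleTree Γ R B
  | hole (x : B) : HoleTree Γ R B

namespace HoleTree

variable {Γ R S T : RankedAlphabet} {B C D : Type}

open Classical in
/-- The number of nodes labelled by the letter `r` of `R`. -/
noncomputable def countLetter (r : R.letters) : HoleTree Γ R B → ℕ
  | out _ c => ∑ k, countLetter r (c k)
  | reg r' c => (if r' = r then 1 else 0) + ∑ k, countLetter r (c k)
  | hole _ => 0

open Classical in
/-- The number of leaves labelled by the element `x` of `B`. -/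
noncomputable def countHole (x : B) : HoleTree Γ R B → ℕ
  | out _ c => ∑ k, countHole x (c k)
  | reg _ c => ∑ k, countHole x (c k)
  | hole y => if y = x then 1 else 0

/-- For a set `X` of letters of `R`, the linear trees over the restricted alphabet `R|_X` and
`O(B)`: the letters of `X` and the elements of `B` occur exactly once each, and the letters of `R`
outside `X` do not occur. -/
def IsLinearOn (X : Set R.letters) (t : HoleTree Γ R B) : Prop :=
  (∀ r ∈ X, t.countLetter r = 1) ∧ (∀ r ∉ X, t.countLetter r = 0) ∧ ∀ x, t.countHole x = 1

/-- `t[k b / b]`: substitution of the leaves labelled by `b : B` by the trees `k b`. -/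
def graft (k : B → HoleTree Γ R C) : HoleTree Γ R B → HoleTree Γ R C
  | out b c => out b fun i => graft k (c i)
  | reg r c => reg r fun i => graft k (c i)
  | hole x => k x

/-- Composition of multimorphisms: each node labelled by a letter `s` of `S`, with immediate
subtrees `c`, is replaced by the tree `w s`, in which the composites of the subtrees `c b` are
substituted for the leaves `b`. -/
def subst (w : ∀ s : S.letters, HoleTree Γ R (S.arity s)) : HoleTree Γ S B → HoleTree Γ R B
  | out b c => out b fun i => subst w (c i)
  | reg s c => graft (fun b => subst w (c b)) (w s)
  | hole x => hole x

/-- The tree consisting of one node `r` whose immediate subtrees are the holes. -/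
def letter (r : R.letters) : HoleTree Γ R (R.arity r) :=
  reg r fun b => hole b

theorem graft_hole (t : HoleTree Γ R B) : t.graft hole = t := by
  induction t with
  | out b c ih => simp only [graft, ih]
  | reg r c ih => simp only [graft, ih]
  | hole x => rfl

theorem graft_graft (k : B → HoleTree Γ R C) (l : C → HoleTree Γ R D) (t : HoleTree Γ R B) :
    (t.graft k).graft l = t.graft fun b => (k b).graft l := by
  induction t with
  | out b c ih => simp only [graft, ih]
  | reg r c ih => simp only [graft, ih]
  | hole x => rfl

theorem subst_letter (t : HoleTree Γ R B) : t.subst letter = t := by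
  induction t with
  | out b c ih => simp only [subst, ih]
  | reg r c ih => simp only [subst, ih, letter, graft]
  | hole x => rfl

theorem letter_subst (w : ∀ s : S.letters, HoleTree Γ R (S.arity s)) (s : S.letters) :
    (letter s).subst w = w s := by
  simp only [letter, subst, graft_hole]

theorem graft_subst (w : ∀ s : S.letters, HoleTree Γ R (S.arity s)) (k : B → HoleTree Γ S C)
    (t : HoleTree Γ S B) :
    (t.graft k).subst w = (t.subst w).graft fun b => (k b).subst w := by
  induction t with
  | out b c ih => simp only [graft, subst, ih]
  | reg r c ih => simp only [graft, subst, ih, graft_graft]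
  | hole x => rfl

theorem subst_subst (w : ∀ s : S.letters, HoleTree Γ R (S.arity s))
    (z : ∀ s : T.letters, HoleTree Γ S (T.arity s)) (t : HoleTree Γ T B) :
    (t.subst z).subst w = t.subst fun s => (z s).subst w := by
  induction t with
  | out b c ih => simp only [subst, ih]
  | reg r c ih => simp only [subst, ih, graft_subst]
  | hole x => rfl

theorem countHole_graft (k : B → HoleTree Γ R C) [Fintype B] (t : HoleTree Γ R B) (x : C) :
    (t.graft k).countHole x = ∑ b, t.countHole b * (k b).countHole x := by
  induction t with
  | out b c ih =>
    simp only [graft, countHole, ih, Finset.sum_mul]; exact Finset.sum_comm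
  | reg r c ih =>
    simp only [graft, countHole, ih, Finset.sum_mul]; exact Finset.sum_comm
  | hole y =>
    simp only [graft, countHole]
    rw [Finset.sum_eq_single y] <;> simp +contextual [eq_comm]

theorem countLetter_graft (k : B → HoleTree Γ R C) [Fintype B] (t : HoleTree Γ R B)
    (r : R.letters) :
    (t.graft k).countLetter r =
      t.countLetter r + ∑ b, t.countHole b * (k b).countLetter r := by
  induction t with
  | out b c ih =>
    simp only [graft, countLetter, countHole, ih, Finset.sum_mul, Finset.sum_add_distrib]
    rw [Finset.sum_comm]
  | reg r' c ih =>
    simp only [graft, countLetter, countHole, ih, Finset.sum_mul, Finset.sum_add_distrib]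
    rw [Finset.sum_comm, add_assoc]
  | hole y =>
    simp only [graft, countLetter, countHole]
    rw [Finset.sum_eq_single y] <;> simp +contextual [eq_comm]

theorem countHole_subst (w : ∀ s : S.letters, HoleTree Γ R (S.arity s))
    (hw : ∀ s b, (w s).countHole b = 1) (t : HoleTree Γ S B) (x : B) :
    (t.subst w).countHole x = t.countHole x := by
  induction t with
  | out b c ih => simp only [subst, countHole, ih]
  | reg s c ih => simp only [subst, countHole_graft, hw, ih, countHole, one_mul]
  | hole y => rfl

theorem countLetter_subst (w : ∀ s : S.letters, HoleTree Γ R (S.arity s))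
    (hw : ∀ s b, (w s).countHole b = 1) (t : HoleTree Γ S B) (r : R.letters) :
    (t.subst w).countLetter r = ∑ s, t.countLetter s * (w s).countLetter r := by
  induction t with
  | out b c ih =>
    simp only [subst, countLetter, ih, Finset.sum_mul]; exact Finset.sum_comm
  | reg s c ih =>
    simp only [subst, countLetter_graft, hw, ih, countLetter, one_mul, add_mul, Finset.sum_mul,
      Finset.sum_add_distrib]
    rw [Finset.sum_comm]
    congr 1
    symm
    rw [Finset.sum_eq_single s] <;> simp +contextual [eq_comm]
  | hole y => simp [subst, countLetter]

/-- Substituting linear trees over disjoint sets of letters (the fibres of a partial function `p`)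
into a linear tree yields a linear tree. -/
theorem isLinearOn_subst {p : R.letters → Option S.letters}
    {w : ∀ s : S.letters, HoleTree Γ R (S.arity s)}
    (hw : ∀ s, (w s).IsLinearOn {r | p r = some s}) {Y : Set S.letters} {t : HoleTree Γ S B}
    (ht : t.IsLinearOn Y) {X : Set R.letters} (hX : ∀ r, r ∈ X ↔ ∃ s ∈ Y, p r = some s) :
    (t.subst w).IsLinearOn X := by
  have hw' : ∀ s b, (w s).countHole b = 1 := fun s => (hw s).2.2
  refine ⟨fun r hr => ?_, fun r hr => ?_, fun x => ?_⟩
  · obtain ⟨s, hs, hp⟩ := (hX r).1 hr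
    rw [countLetter_subst w hw', Finset.sum_eq_single s, ht.1 s hs, (hw s).1 r hp]
    · intro s' _ hs'
      rw [(hw s').2.1 r fun h => hs' (Option.some_injective _ (Eq.trans (Eq.symm h) hp)), mul_zero]
    · simp
  · rw [countLetter_subst w hw']
    refine Finset.sum_eq_zero fun s _ => ?_
    by_cases hs : s ∈ Y
    · rw [(hw s).2.1 r fun h => hr ((hX r).2 ⟨s, hs, h⟩), mul_zero]
    · rw [ht.2.1 s hs, zero_mul]
  · rw [countHole_subst w hw', ht.2.2]

/-- A node labelled by `r` and holes numbered by a bijection `e` is linear. -/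
theorem isLinearOn_reg_hole (r : R.letters) (e : R.arity r ≃ B) {X : Set R.letters}
    (hX : ∀ r', r' ∈ X ↔ r' = r) :
    (reg (Γ := Γ) r fun b => hole (e b)).IsLinearOn X := by
  refine ⟨fun r' hr => ?_, fun r' hr => ?_, fun x => ?_⟩
  · simp [countLetter, (hX r').1 hr]
  · have : r ≠ r' := fun h => hr ((hX r').2 h.symm)
    simp [countLetter, this]
  · simp only [countHole]
    rw [Finset.sum_eq_single (e.symm x)] <;> aesop

end HoleTree

/-! ### The category of register transitions -/

/-- The objects of the category of `Γ`-register transitions for trees. An object `⊗_{i ∈ I} A_i`,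
where `(A_i)_{i ∈ I}` is a finite family of finite sets, is presented as the ranked alphabet
`(I, A)`. -/
def Register (_Γ : RankedAlphabet) : Type 1 := RankedAlphabet

namespace Register

variable {Γ : RankedAlphabet}

/-- A morphism `⊗_{i ∈ I} A_i → ⊗_{j ∈ J} B_j`: a partial function `f : I ⇀ J` and, for every
`j ∈ J`, a multimorphism `(A_i)_{i ∈ f⁻¹(j)} → B_j`, that is, a linear tree over the letters in
`f⁻¹(j)` and the holes in `B_j`. -/
structure Hom (R S : RankedAlphabet) where
  support : R.letters → Option S.letters
  tree : ∀ s, HoleTree Γ R (S.arity s)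
  isLinearOn : ∀ s, (tree s).IsLinearOn {r | support r = some s}

/-- The partial function is determined by the trees. -/
@[ext]
theorem Hom.ext {R S : RankedAlphabet} {f g : Hom (Γ := Γ) R S} (h : ∀ s, f.tree s = g.tree s) :
    f = g := by
  have hs : f.support = g.support := by
    funext r
    ext s
    have h1 := f.isLinearOn s
    have h2 := g.isLinearOn s
    rw [h s] at h1
    constructor
    · intro hf
      by_contra hg
      exact absurd ((h1.1 r hf).symm.trans (h2.2.1 r hg)) one_ne_zero
    · intro hg
      by_contra hf
      exact absurd ((h2.1 r hg).symm.trans (h1.2.1 r hf)) one_ne_zero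
  obtain ⟨a, t, hf⟩ := f
  obtain ⟨a', t', hg⟩ := g
  obtain rfl : a = a' := hs
  obtain rfl : t = t' := funext h
  rfl

/-- The morphism that relabels letters along a bijection and holes along bijections. -/
def relabel {R S : RankedAlphabet} (σ : S.letters ≃ R.letters)
    (e : ∀ s, R.arity (σ s) ≃ S.arity s) : Hom (Γ := Γ) R S where
  support := fun r => some (σ.symm r)
  tree := fun s => .reg (σ s) fun b => .hole (e s b)
  isLinearOn := fun s => HoleTree.isLinearOn_reg_hole (σ s) (e s) fun r => by
    change some (σ.symm r) = some s ↔ r = σ s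
    rw [Option.some_inj, Equiv.symm_apply_eq]

def Hom.id (R : RankedAlphabet) : Hom (Γ := Γ) R R where
  support := some
  tree := fun r => .letter r
  isLinearOn := (relabel (Equiv.refl _) fun _ => Equiv.refl _).isLinearOn

def Hom.comp {R S T : RankedAlphabet} (f : Hom (Γ := Γ) R S) (g : Hom (Γ := Γ) S T) :
    Hom (Γ := Γ) R T where
  support := fun r => (f.support r).bind g.support
  tree := fun t => (g.tree t).subst f.tree
  isLinearOn := fun t => HoleTree.isLinearOn_subst f.isLinearOn (g.isLinearOn t) fun r => by
    change (f.support r).bind g.support = some t ↔ ∃ s, g.support s = some t ∧ f.support r = some s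
    rw [Option.bind_eq_some_iff]
    simp only [and_comm]

instance category (Γ : RankedAlphabet) : Category (Register Γ) where
  Hom R S := Hom (Γ := Γ) R S
  id R := Hom.id R
  comp f g := Hom.comp f g
  id_comp _ := Hom.ext fun _ => HoleTree.subst_letter _
  comp_id _ := Hom.ext fun _ => HoleTree.letter_subst _ _
  assoc _ _ _ := Hom.ext fun _ => (HoleTree.subst_subst _ _ _).symm

theorem sum_elim_some_none {α β : Type} (a : α) (r : α ⊕ β) :
    Sum.elim some (fun _ => none) r = some a ↔ r = Sum.inl a := by
  rcases r with r | r <;> simp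

theorem sum_elim_none_some {α β : Type} (b : β) (r : α ⊕ β) :
    Sum.elim (fun _ => none) some r = some b ↔ r = Sum.inr b := by
  rcases r with r | r <;> simp

theorem sum_elim_map_inl {α β γ δ : Type} (f : α → Option γ) (g : β → Option δ) (c : γ)
    (r : α ⊕ β) :
    Sum.elim (fun r => (f r).map Sum.inl) (fun r => (g r).map Sum.inr) r = some (Sum.inl c) ↔
      ∃ a, f a = some c ∧ Sum.elim some (fun _ => none) r = some a := by
  rcases r with r | r <;> simp

theorem sum_elim_map_inr {α β γ δ : Type} (f : α → Option γ) (g : β → Option δ) (d : δ)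
    (r : α ⊕ β) :
    Sum.elim (fun r => (f r).map Sum.inl) (fun r => (g r).map Sum.inr) r = some (Sum.inr d) ↔
      ∃ b, g b = some d ∧ Sum.elim (fun _ => none) some r = some b := by
  rcases r with r | r <;> simp

/-- The tensor product of morphisms, which act side by side on the two disjoint alphabets. -/
def Hom.tensor {R S R' S' : RankedAlphabet} (f : Hom (Γ := Γ) R S) (g : Hom (Γ := Γ) R' S') :
    Hom (Γ := Γ) (R.tensor R') (S.tensor S') where
  support := Sum.elim (fun r => (f.support r).map Sum.inl) (fun r => (g.support r).map Sum.inr)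
  tree := fun s => match s with
    | .inl s => (f.tree s).subst fun r => HoleTree.letter (R := R.tensor R') (Sum.inl r)
    | .inr s => (g.tree s).subst fun r => HoleTree.letter (R := R.tensor R') (Sum.inr r)
  isLinearOn := fun s => match s with
    | .inl s => HoleTree.isLinearOn_subst (S := R) (p := Sum.elim some fun _ => none)
        (fun _ => HoleTree.isLinearOn_reg_hole (R := R.tensor R') _ (Equiv.refl _)
          (sum_elim_some_none _)) (f.isLinearOn s) (by exact sum_elim_map_inl f.support g.support s)
    | .inr s => HoleTree.isLinearOn_subst (S := R') (p := Sum.elim (fun _ => none) some)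
        (fun _ => HoleTree.isLinearOn_reg_hole (R := R.tensor R') _ (Equiv.refl _)
          (sum_elim_none_some _)) (g.isLinearOn s) (by exact sum_elim_map_inr f.support g.support s)

/-- The isomorphism `(R ⊗ S) ⊗ T ≅ R ⊗ (S ⊗ T)` induced by `(I + J) + K ≅ I + (J + K)`. -/
def assocIso (R S T : Register Γ) :
    Iso (C := Register Γ) (RankedAlphabet.tensor (RankedAlphabet.tensor R S) T)
      (RankedAlphabet.tensor R (RankedAlphabet.tensor S T)) where
  hom := relabel (Equiv.sumAssoc _ _ _).symm fun s => match s with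
    | .inl _ => Equiv.refl _
    | .inr (.inl _) => Equiv.refl _
    | .inr (.inr _) => Equiv.refl _
  inv := relabel (Equiv.sumAssoc _ _ _) fun s => match s with
    | .inl (.inl _) => Equiv.refl _
    | .inl (.inr _) => Equiv.refl _
    | .inr _ => Equiv.refl _
  hom_inv_id := Hom.ext (by rintro ((s | s) | s) <;> rfl)
  inv_hom_id := Hom.ext (by rintro (s | s | s) <;> rfl)

/-- The isomorphism `⊤ ⊗ R ≅ R` induced by `∅ + I ≅ I`. -/
def leftUnitIso (R : Register Γ) :
    Iso (C := Register Γ) (RankedAlphabet.tensor RankedAlphabet.empty R) R where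
  hom := relabel (Equiv.emptySum Empty _).symm fun _ => Equiv.refl _
  inv := relabel (Equiv.emptySum Empty _) fun s => match s with
    | .inr _ => Equiv.refl _
  hom_inv_id := Hom.ext (by rintro (s | s); exacts [s.elim, rfl])
  inv_hom_id := Hom.ext fun _ => rfl

/-- The isomorphism `R ⊗ ⊤ ≅ R` induced by `I + ∅ ≅ I`. -/
def rightUnitIso (R : Register Γ) :
    Iso (C := Register Γ) (RankedAlphabet.tensor R RankedAlphabet.empty) R where
  hom := relabel (Equiv.sumEmpty _ Empty).symm fun _ => Equiv.refl _
  inv := relabel (Equiv.sumEmpty _ Empty) fun s => match s with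
    | .inl _ => Equiv.refl _
  hom_inv_id := Hom.ext (by rintro (s | s); exacts [rfl, s.elim])
  inv_hom_id := Hom.ext fun _ => rfl

/-- The symmetry `R ⊗ S ≅ S ⊗ R` induced by `I + J ≅ J + I`. -/
def swapIso (R S : Register Γ) :
    Iso (C := Register Γ) (RankedAlphabet.tensor R S) (RankedAlphabet.tensor S R) where
  hom := relabel (Equiv.sumComm _ _) fun s => match s with
    | .inl _ => Equiv.refl _
    | .inr _ => Equiv.refl _
  inv := relabel (Equiv.sumComm _ _) fun s => match s with
    | .inl _ => Equiv.refl _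
    | .inr _ => Equiv.refl _
  hom_inv_id := Hom.ext (by rintro (s | s) <;> rfl)
  inv_hom_id := Hom.ext (by rintro (s | s) <;> rfl)

instance monoidalStruct (Γ : RankedAlphabet) : MonoidalCategoryStruct (Register Γ) where
  tensorObj R S := RankedAlphabet.tensor R S
  tensorHom f g := Hom.tensor f g
  whiskerLeft R _ _ f := Hom.tensor (Hom.id R) f
  whiskerRight f R := Hom.tensor f (Hom.id R)
  tensorUnit := RankedAlphabet.empty
  associator R S T := assocIso R S T
  leftUnitor R := leftUnitIso R
  rightUnitor R := rightUnitIso R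

theorem subst_inl {R S T : RankedAlphabet} {B : Type} (t : HoleTree Γ R B)
    (w : ∀ s : (R.tensor S).letters, HoleTree Γ T ((R.tensor S).arity s)) :
    (t.subst fun r => HoleTree.letter (R := R.tensor S) (Sum.inl r)).subst w =
      t.subst fun r => w (Sum.inl r) :=
  (HoleTree.subst_subst _ _ _).trans
    (congrArg (fun z => HoleTree.subst z t) (funext fun r => HoleTree.letter_subst w (Sum.inl r)))

theorem subst_inr {R S T : RankedAlphabet} {B : Type} (t : HoleTree Γ S B)
    (w : ∀ s : (R.tensor S).letters, HoleTree Γ T ((R.tensor S).arity s)) :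
    (t.subst fun r => HoleTree.letter (R := R.tensor S) (Sum.inr r)).subst w =
      t.subst fun r => w (Sum.inr r) :=
  (HoleTree.subst_subst _ _ _).trans
    (congrArg (fun z => HoleTree.subst z t) (funext fun r => HoleTree.letter_subst w (Sum.inr r)))

theorem Hom.tensor_comp {R S T R' S' T' : RankedAlphabet} (f : Hom (Γ := Γ) R S)
    (g : Hom (Γ := Γ) S T) (f' : Hom (Γ := Γ) R' S') (g' : Hom (Γ := Γ) S' T') :
    (f.tensor f').comp (g.tensor g') = (f.comp g).tensor (f'.comp g') := by
  ext (t | t)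
  · exact (subst_inl _ _).trans (HoleTree.subst_subst _ _ _).symm
  · exact (subst_inr _ _).trans (HoleTree.subst_subst _ _ _).symm

instance monoidal (Γ : RankedAlphabet) : MonoidalCategory (Register Γ) :=
  MonoidalCategory.ofTensorHom
    (id_tensorHom_id := fun R S => Hom.ext (by
      rintro (s | s) <;> exact HoleTree.letter_subst _ _))
    (id_tensorHom := fun _ _ _ _ => rfl)
    (tensorHom_id := fun _ _ => rfl)
    (tensorHom_comp_tensorHom := fun f g f' g' => Hom.tensor_comp f f' g g')
    (pentagon := fun W X Y Z => Hom.ext (by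
      rintro (s | s | s | s) <;> rfl))
    (triangle := fun X Y => Hom.ext (by
      rintro (s | s) <;> rfl))
    (associator_naturality := fun {X₁ X₂ X₃ Y₁ Y₂ Y₃} f g h => Hom.ext (by
      rintro (s | s | s)
      · exact (HoleTree.letter_subst (Hom.tensor (Hom.tensor f g) h).tree (.inl (.inl s))).trans
          ((subst_inl _ _).trans (subst_inl _ (assocIso X₁ X₂ X₃).hom.tree).symm)
      · exact (HoleTree.letter_subst (Hom.tensor (Hom.tensor f g) h).tree (.inl (.inr s))).trans
          ((subst_inr _ _).trans
            ((subst_inr _ (assocIso X₁ X₂ X₃).hom.tree).trans (subst_inl _ _)).symm)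
      · exact (HoleTree.letter_subst (Hom.tensor (Hom.tensor f g) h).tree (.inr s)).trans
          ((subst_inr _ (assocIso X₁ X₂ X₃).hom.tree).trans (subst_inr _ _)).symm))
    (leftUnitor_naturality := fun {X Y} f => Hom.ext fun s =>
      HoleTree.letter_subst (Hom.tensor (Hom.id RankedAlphabet.empty) f).tree (.inr s))
    (rightUnitor_naturality := fun {X Y} f => Hom.ext fun s =>
      HoleTree.letter_subst (Hom.tensor f (Hom.id RankedAlphabet.empty)).tree (.inl s))

theorem swap_naturality {R S R' S' : Register Γ} (f : R ⟶ S) (g : R' ⟶ S') :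
    (f ⊗ₘ g) ≫ (swapIso S S').hom = (swapIso R R').hom ≫ (g ⊗ₘ f) :=
  Hom.ext (by
    rintro (s | s)
    · exact (HoleTree.letter_subst (Hom.tensor f g).tree (.inr s)).trans
        (subst_inl _ (swapIso R R').hom.tree).symm
    · exact (HoleTree.letter_subst (Hom.tensor f g).tree (.inl s)).trans
        (subst_inr _ (swapIso R R').hom.tree).symm)

instance braided (Γ : RankedAlphabet) : BraidedCategory (Register Γ) where
  braiding R S := swapIso R S
  braiding_naturality_right X _ _ f := swap_naturality (𝟙 X) f
  braiding_naturality_left f Z := swap_naturality f (𝟙 Z)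
  hexagon_forward _ _ _ := Hom.ext (by rintro (s | s | s) <;> rfl)
  hexagon_reverse _ _ _ := Hom.ext (by rintro ((s | s) | s) <;> rfl)

end Register

/-! ### The free finite coproduct completion -/

/-- Objects of the free finite coproduct completion `C_⊕`: finite formal sums `⊕_{u ∈ U} C_u` of
objects of `C`. -/
structure FinCoprod (C : Type u) : Type (max u 1) where
  index : Type
  [finiteIndex : Finite index]
  obj : index → C

attribute [instance] FinCoprod.finiteIndex

namespace FinCoprod

variable {C : Type u} [Category.{v} C]

/-- A morphism `⊕_{u ∈ U} C_u ⟶ ⊕_{v ∈ V} D_v` is an element of `∏_u ∑_v Hom (C_u, D_v)`. -/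
structure Hom (X Y : FinCoprod C) : Type v where
  idx : X.index → Y.index
  hom : ∀ u, X.obj u ⟶ Y.obj (idx u)

theorem Hom.ext' {X Y : FinCoprod C} {i : X.index → Y.index} {f g : ∀ u, X.obj u ⟶ Y.obj (i u)}
    (h : ∀ u, f u = g u) : (⟨i, f⟩ : Hom X Y) = ⟨i, g⟩ := by
  rw [funext h]

instance category : Category (FinCoprod C) where
  Hom := Hom
  id X := ⟨id, fun u => 𝟙 (X.obj u)⟩
  comp f g := ⟨fun u => g.idx (f.idx u), fun u => f.hom u ≫ g.hom (f.idx u)⟩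
  id_comp _ := Hom.ext' fun _ => Category.id_comp _
  comp_id _ := Hom.ext' fun _ => Category.comp_id _
  assoc _ _ _ := Hom.ext' fun _ => Category.assoc _ _ _

/-- The embedding `ι_⊕` on objects, which sends `A` to the one-element family. -/
def ι (A : C) : FinCoprod C := ⟨PUnit, fun _ => A⟩

variable [MonoidalCategory C]

/-- The lifted tensor product `(⊕_u C_u) ⊗ (⊕_v D_v) = ⊕_{(u,v)} C_u ⊗ D_v`, with unit `ι_⊕(1)`. -/
instance monoidalStruct : MonoidalCategoryStruct (FinCoprod C) where
  tensorObj X Y := ⟨X.index × Y.index, fun p => X.obj p.1 ⊗ Y.obj p.2⟩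
  tensorHom f g := ⟨fun p => (f.idx p.1, g.idx p.2), fun p => f.hom p.1 ⊗ₘ g.hom p.2⟩
  whiskerLeft X _ _ g := ⟨fun p => (p.1, g.idx p.2), fun p => X.obj p.1 ◁ g.hom p.2⟩
  whiskerRight f Y := ⟨fun p => (f.idx p.1, p.2), fun p => f.hom p.1 ▷ Y.obj p.2⟩
  tensorUnit := ι (𝟙_ C)
  associator _ _ _ :=
    { hom := ⟨fun p => (p.1.1, p.1.2, p.2), fun _ => (α_ _ _ _).hom⟩
      inv := ⟨fun p => ((p.1, p.2.1), p.2.2), fun _ => (α_ _ _ _).inv⟩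
      hom_inv_id := Hom.ext' fun _ => Iso.hom_inv_id _
      inv_hom_id := Hom.ext' fun _ => Iso.inv_hom_id _ }
  leftUnitor _ :=
    { hom := ⟨fun p => p.2, fun _ => (λ_ _).hom⟩
      inv := ⟨fun u => (PUnit.unit, u), fun _ => (λ_ _).inv⟩
      hom_inv_id := Hom.ext' fun _ => Iso.hom_inv_id _
      inv_hom_id := Hom.ext' fun _ => Iso.inv_hom_id _ }
  rightUnitor _ :=
    { hom := ⟨fun p => p.1, fun _ => (ρ_ _).hom⟩
      inv := ⟨fun u => (u, PUnit.unit), fun _ => (ρ_ _).inv⟩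
      hom_inv_id := Hom.ext' fun _ => Iso.hom_inv_id _
      inv_hom_id := Hom.ext' fun _ => Iso.inv_hom_id _ }

instance monoidal : MonoidalCategory (FinCoprod C) :=
  MonoidalCategory.ofTensorHom
    (id_tensorHom_id := fun _ _ => Hom.ext' fun _ => MonoidalCategory.id_tensorHom_id _ _)
    (id_tensorHom := fun _ _ _ _ => Hom.ext' fun _ => MonoidalCategory.id_tensorHom _ _)
    (tensorHom_id := fun _ _ => Hom.ext' fun _ => MonoidalCategory.tensorHom_id _ _)
    (tensorHom_comp_tensorHom := fun _ _ _ _ => Hom.ext' fun _ =>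
      MonoidalCategory.tensorHom_comp_tensorHom _ _ _ _)
    (associator_naturality := fun _ _ _ => Hom.ext' fun _ =>
      MonoidalCategory.associator_naturality _ _ _)
    (leftUnitor_naturality := fun f => Hom.ext' fun p => by
      exact (congrArg (· ≫ _) (MonoidalCategory.id_tensorHom _ _)).trans
        (MonoidalCategory.leftUnitor_naturality (f.hom p.2)))
    (rightUnitor_naturality := fun f => Hom.ext' fun p => by
      exact (congrArg (· ≫ _) (MonoidalCategory.tensorHom_id _ _)).trans
        (MonoidalCategory.rightUnitor_naturality (f.hom p.1)))
    (pentagon := fun W X Y Z => Hom.ext' fun p => by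
      have := MonoidalCategory.pentagon (W.obj p.1.1.1) (X.obj p.1.1.2) (Y.obj p.1.2) (Z.obj p.2)
      rw [← MonoidalCategory.id_tensorHom, ← MonoidalCategory.tensorHom_id] at this
      exact this)
    (triangle := fun X Y => Hom.ext' fun p => by
      have := MonoidalCategory.triangle (X.obj p.1.1) (Y.obj p.2)
      rw [← MonoidalCategory.id_tensorHom, ← MonoidalCategory.tensorHom_id] at this
      exact this)

instance braided [BraidedCategory C] : BraidedCategory (FinCoprod C) where
  braiding _ _ :=
    { hom := ⟨fun p => (p.2, p.1), fun _ => (β_ _ _).hom⟩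
      inv := ⟨fun p => (p.2, p.1), fun _ => (β_ _ _).inv⟩
      hom_inv_id := Hom.ext' fun _ => Iso.hom_inv_id _
      inv_hom_id := Hom.ext' fun _ => Iso.inv_hom_id _ }
  braiding_naturality_right _ _ _ _ := Hom.ext' fun _ =>
    BraidedCategory.braiding_naturality_right _ _
  braiding_naturality_left _ _ := Hom.ext' fun _ => BraidedCategory.braiding_naturality_left _ _
  hexagon_forward _ _ _ := Hom.ext' fun _ => BraidedCategory.hexagon_forward _ _ _
  hexagon_reverse _ _ _ := Hom.ext' fun _ => BraidedCategory.hexagon_reverse _ _ _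

end FinCoprod

/-! ### The Dialectica-like completion -/

/-- Objects of the completion `C_⊕&`, the composite `(C_&)_⊕` of the free finite product completion
and the free finite coproduct completion: finite formal sums of finite formal products
`⊕_{u ∈ U} &_{x ∈ X_u} C_{u,x}` of objects of `C`. -/
structure FinCoprodProd (C : Type u) : Type (max u 1) where
  index : Type
  [finiteIndex : Finite index]
  fiber : index → Type
  [finiteFiber : ∀ u, Finite (fiber u)]
  obj : ∀ u, fiber u → C

attribute [instance] FinCoprodProd.finiteIndex FinCoprodProd.finiteFiber

namespace FinCoprodProd

variable {C : Type u} [Category.{v} C]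

/-- A morphism `⊕_u &_x C_{u,x} ⟶ ⊕_v &_y D_{v,y}` is an element of
`∏_u ∑_v ∏_y ∑_x Hom (C_{u,x}, D_{v,y})`. -/
structure Hom (A B : FinCoprodProd C) : Type v where
  idx : A.index → B.index
  fib : ∀ u, B.fiber (idx u) → A.fiber u
  hom : ∀ u y, A.obj u (fib u y) ⟶ B.obj (idx u) y

theorem Hom.ext' {A B : FinCoprodProd C} {i : A.index → B.index} {k : ∀ u, B.fiber (i u) → A.fiber u}
    {f g : ∀ u y, A.obj u (k u y) ⟶ B.obj (i u) y}
    (h : ∀ u y, f u y = g u y) : (⟨i, k, f⟩ : Hom A B) = ⟨i, k, g⟩ := by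
  obtain rfl : f = g := funext fun u => funext (h u)
  rfl

instance category : Category (FinCoprodProd C) where
  Hom := Hom
  id A := ⟨id, fun _ => id, fun u x => 𝟙 (A.obj u x)⟩
  comp f g := ⟨fun u => g.idx (f.idx u), fun u z => f.fib u (g.fib (f.idx u) z),
    fun u z => f.hom u (g.fib (f.idx u) z) ≫ g.hom (f.idx u) z⟩
  id_comp _ := Hom.ext' fun _ _ => Category.id_comp _
  comp_id _ := Hom.ext' fun _ _ => Category.comp_id _
  assoc _ _ _ := Hom.ext' fun _ _ => Category.assoc _ _ _

variable [MonoidalCategory C]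

/-- The lifted tensor product, which distributes over formal sums and formal products:
`(⊕_u &_x C_{u,x}) ⊗ (⊕_v &_y D_{v,y}) = ⊕_{(u,v)} &_{(x,y)} C_{u,x} ⊗ D_{v,y}`. Its unit is the
one-element family consisting of the unit of `C`. -/
instance monoidalStruct : MonoidalCategoryStruct (FinCoprodProd C) where
  tensorObj A B := ⟨A.index × B.index, fun p => A.fiber p.1 × B.fiber p.2,
    fun p q => A.obj p.1 q.1 ⊗ B.obj p.2 q.2⟩
  tensorHom f g := ⟨fun p => (f.idx p.1, g.idx p.2), fun p q => (f.fib p.1 q.1, g.fib p.2 q.2),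
    fun p q => f.hom p.1 q.1 ⊗ₘ g.hom p.2 q.2⟩
  whiskerLeft A _ _ g := ⟨fun p => (p.1, g.idx p.2), fun p q => (q.1, g.fib p.2 q.2),
    fun p q => A.obj p.1 q.1 ◁ g.hom p.2 q.2⟩
  whiskerRight f B := ⟨fun p => (f.idx p.1, p.2), fun p q => (f.fib p.1 q.1, q.2),
    fun p q => f.hom p.1 q.1 ▷ B.obj p.2 q.2⟩
  tensorUnit := ⟨PUnit, fun _ => PUnit, fun _ _ => 𝟙_ C⟩
  associator _ _ _ :=
    { hom := ⟨fun p => (p.1.1, p.1.2, p.2), fun _ q => ((q.1, q.2.1), q.2.2),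
        fun _ _ => (α_ _ _ _).hom⟩
      inv := ⟨fun p => ((p.1, p.2.1), p.2.2), fun _ q => (q.1.1, q.1.2, q.2),
        fun _ _ => (α_ _ _ _).inv⟩
      hom_inv_id := Hom.ext' fun _ _ => Iso.hom_inv_id _
      inv_hom_id := Hom.ext' fun _ _ => Iso.inv_hom_id _ }
  leftUnitor _ :=
    { hom := ⟨fun p => p.2, fun _ x => (PUnit.unit, x), fun _ _ => (λ_ _).hom⟩
      inv := ⟨fun u => (PUnit.unit, u), fun _ q => q.2, fun _ _ => (λ_ _).inv⟩
      hom_inv_id := Hom.ext' fun _ _ => Iso.hom_inv_id _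
      inv_hom_id := Hom.ext' fun _ _ => Iso.inv_hom_id _ }
  rightUnitor _ :=
    { hom := ⟨fun p => p.1, fun _ x => (x, PUnit.unit), fun _ _ => (ρ_ _).hom⟩
      inv := ⟨fun u => (u, PUnit.unit), fun _ q => q.1, fun _ _ => (ρ_ _).inv⟩
      hom_inv_id := Hom.ext' fun _ _ => Iso.hom_inv_id _
      inv_hom_id := Hom.ext' fun _ _ => Iso.inv_hom_id _ }

instance monoidal : MonoidalCategory (FinCoprodProd C) :=
  MonoidalCategory.ofTensorHom
    (id_tensorHom_id := fun _ _ => Hom.ext' fun _ _ => MonoidalCategory.id_tensorHom_id _ _)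
    (id_tensorHom := fun _ _ _ _ => Hom.ext' fun _ _ => MonoidalCategory.id_tensorHom _ _)
    (tensorHom_id := fun _ _ => Hom.ext' fun _ _ => MonoidalCategory.tensorHom_id _ _)
    (tensorHom_comp_tensorHom := fun _ _ _ _ => Hom.ext' fun _ _ =>
      MonoidalCategory.tensorHom_comp_tensorHom _ _ _ _)
    (associator_naturality := fun _ _ _ => Hom.ext' fun _ _ =>
      MonoidalCategory.associator_naturality _ _ _)
    (leftUnitor_naturality := fun f => Hom.ext' fun p y => by
      exact (congrArg (· ≫ _) (MonoidalCategory.id_tensorHom _ _)).trans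
        (MonoidalCategory.leftUnitor_naturality (f.hom p.2 y)))
    (rightUnitor_naturality := fun f => Hom.ext' fun p y => by
      exact (congrArg (· ≫ _) (MonoidalCategory.tensorHom_id _ _)).trans
        (MonoidalCategory.rightUnitor_naturality (f.hom p.1 y)))
    (pentagon := fun W X Y Z => Hom.ext' fun p q => by
      have := MonoidalCategory.pentagon (W.obj p.1.1.1 q.1) (X.obj p.1.1.2 q.2.1)
        (Y.obj p.1.2 q.2.2.1) (Z.obj p.2 q.2.2.2)
      rw [← MonoidalCategory.id_tensorHom, ← MonoidalCategory.tensorHom_id] at this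
      exact this)
    (triangle := fun X Y => Hom.ext' fun p q => by
      have := MonoidalCategory.triangle (X.obj p.1.1 q.1) (Y.obj p.2 q.2)
      rw [← MonoidalCategory.id_tensorHom, ← MonoidalCategory.tensorHom_id] at this
      exact this)

instance braided [BraidedCategory C] : BraidedCategory (FinCoprodProd C) where
  braiding _ _ :=
    { hom := ⟨fun p => (p.2, p.1), fun _ q => (q.2, q.1), fun _ _ => (β_ _ _).hom⟩
      inv := ⟨fun p => (p.2, p.1), fun _ q => (q.2, q.1), fun _ _ => (β_ _ _).inv⟩
      hom_inv_id := Hom.ext' fun _ _ => Iso.hom_inv_id _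
      inv_hom_id := Hom.ext' fun _ _ => Iso.inv_hom_id _ }
  braiding_naturality_right _ _ _ _ := Hom.ext' fun _ _ =>
    BraidedCategory.braiding_naturality_right _ _
  braiding_naturality_left _ _ := Hom.ext' fun _ _ => BraidedCategory.braiding_naturality_left _ _
  hexagon_forward _ _ _ := Hom.ext' fun _ _ => BraidedCategory.hexagon_forward _ _ _
  hexagon_reverse _ _ _ := Hom.ext' fun _ _ => BraidedCategory.hexagon_reverse _ _ _

end FinCoprodProd

/-- `H`, with evaluation map `ev`, is an internal homset from `A` to `B`. -/
def IsInternalHom {C : Type u} [Category.{v} C] [MonoidalCategory C] (A B H : C)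
    (ev : H ⊗ A ⟶ B) : Prop :=
  ∀ (X : C) (h : X ⊗ A ⟶ B), ∃! k : X ⟶ H, k ▷ A ≫ ev = h

/-! In `Register Γ` a morphism `X ⊗ R ⟶ S` can be curried once a finite amount of combinatorial data
has been recorded. Let `R` have a single letter, of arity `A`. Either the letter is discarded, and
what remains is a morphism `X ⟶ S`; or it occurs in the tree of exactly one `s`, and there exactly
once. In the second case this tree is cut at the node into a stem, with a new leaf at the cut, and
one branch for each `a : A`. By linearity each leaf `b` of `s` lies in exactly one of these pieces,
which gives a function `φ : S.arity s → Option A`. For fixed `(s, φ)` the pieces and the remaining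
trees are precisely a morphism from `X` to the alphabet `S.split A s φ`. Since there are finitely
many pairs `(s, φ)`, the hom-set `Hom (X ⊗ R, S)` is a finite disjoint union of hom-sets `Hom (X,
H_u)`, and the bijection is composition with evaluation maps. This is a `MultiHom`; the case of one
letter is `multiHomSingle`.

Such families exist for the unit, are invariant under isomorphism, and compose along tensor products
by currying twice, so induction on the number of letters gives them for every `R`.

A finite family of this kind is a single object of `C_⊕`, namely the formal sum of the `H_u`, and
this is the internal hom of part 1. In `C_⊕&` the hom-sets `∏ ∑ ∏ ∑ Hom (X_{w,x'} ⊗ A_{u,x},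
B_{v,y})` become `∏ ∑ ∏ ∑ ∑_k Hom (X_{w,x'}, H_k)`. Distributing products over sums moves the
choices of `v`, `x` and `k` into the index of a new object and leaves only `x'` to the morphism
(`isInternalHom_internalEv`). Products and coproducts in `C_⊕&` are formal and exist for every `C`.
-/

/-! ### Internal homs that are families of objects -/

/-- A finite family of objects `H u` with maps `ev u : H u ⊗ R ⟶ S` such that every morphism
`X ⊗ R ⟶ S` factors through exactly one `ev u`, in a unique way. -/
structure MultiHom {C : Type u} [Category.{v} C] [MonoidalCategory C] (R S : C) :
    Type (max u v 1) where
  index : Type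
  [finiteIndex : Finite index]
  obj : index → C
  ev : ∀ u, obj u ⊗ R ⟶ S
  bijective : ∀ X : C,
    Function.Bijective fun p : (Σ u, X ⟶ obj u) => (p.2 ▷ R ≫ ev p.1 : X ⊗ R ⟶ S)

attribute [instance] MultiHom.finiteIndex

namespace MultiHom

variable {C : Type u} [Category.{v} C] [MonoidalCategory C]

noncomputable def curry {R S : C} (K : MultiHom R S) {X : C} (h : X ⊗ R ⟶ S) :
    Σ u, X ⟶ K.obj u :=
  (Equiv.ofBijective _ (K.bijective X)).symm h

theorem curry_ev {R S : C} (K : MultiHom R S) {X : C} (u : K.index) (k : X ⟶ K.obj u) :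
    K.curry (k ▷ R ≫ K.ev u) = ⟨u, k⟩ :=
  (Equiv.ofBijective _ (K.bijective X)).symm_apply_apply ⟨u, k⟩

theorem ev_curry {R S : C} (K : MultiHom R S) {X : C} (h : X ⊗ R ⟶ S) :
    (K.curry h).2 ▷ R ≫ K.ev (K.curry h).1 = h :=
  (Equiv.ofBijective _ (K.bijective X)).apply_symm_apply h

/-- The family of internal homs out of the unit. -/
def ofUnit (S : C) : MultiHom (𝟙_ C) S where
  index := Unit
  obj _ := S
  ev _ := (ρ_ S).hom
  bijective X := by
    constructor
    · rintro ⟨_, k⟩ ⟨_, k'⟩ h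
      have h' : k ▷ 𝟙_ C ≫ (ρ_ S).hom = k' ▷ 𝟙_ C ≫ (ρ_ S).hom := h
      rw [rightUnitor_naturality, rightUnitor_naturality, cancel_epi] at h'
      rw [h']
    · intro h
      exact ⟨⟨(), (ρ_ X).inv ≫ h⟩, by simp⟩

/-- Transport of families of internal homs along an isomorphism. -/
def ofIso {R R' S : C} (i : R ≅ R') (K : MultiHom R S) : MultiHom R' S where
  index := K.index
  obj := K.obj
  ev u := K.obj u ◁ i.inv ≫ K.ev u
  bijective X := by
    -- By interchange `i.inv` slides past `p.2`, so the new map is the old bijection followed by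
    -- precomposition with an isomorphism.
    have h : (fun p : (Σ u, X ⟶ K.obj u) => p.2 ▷ R' ≫ K.obj p.1 ◁ i.inv ≫ K.ev p.1) =
        (fun h => X ◁ i.inv ≫ h) ∘ fun p => p.2 ▷ R ≫ K.ev p.1 := by
      funext p
      simp only [Function.comp_apply, whisker_exchange_assoc]
    rw [h]
    exact (((whiskerLeftIso X i.symm).homFromEquiv (Z := S)).symm.bijective).comp (K.bijective X)

/-- Families of internal homs out of a tensor product, by currying twice. -/
def ofTensor {R R' S : C} (K' : MultiHom R' S) (K : ∀ u : K'.index, MultiHom R (K'.obj u)) :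
    MultiHom (R ⊗ R') S where
  index := Σ u, (K u).index
  obj p := (K p.1).obj p.2
  ev p := (α_ _ _ _).inv ≫ (K p.1).ev p.2 ▷ R' ≫ K'.ev p.1
  bijective X := by
    -- Under `X ⊗ (R ⊗ R') ≅ (X ⊗ R) ⊗ R'`, the factor `R'` is curried first, with target `S`, and
    -- then `R`, with target the `K'.obj u` obtained.
    let F : (Σ p : (Σ u, (K u).index), X ⟶ (K p.1).obj p.2) ≃ (X ⊗ (R ⊗ R') ⟶ S) :=
      (Equiv.sigmaAssoc fun u w => X ⟶ (K u).obj w).trans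
        ((Equiv.sigmaCongrRight fun u => Equiv.ofBijective _ ((K u).bijective X)).trans
          ((Equiv.ofBijective _ (K'.bijective (X ⊗ R))).trans
            (α_ X R R').homFromEquiv))
    have h : (fun p : (Σ p : (Σ u, (K u).index), X ⟶ (K p.1).obj p.2) =>
        p.2 ▷ (R ⊗ R') ≫ (α_ _ _ _).inv ≫ (K p.1.1).ev p.1.2 ▷ R' ≫ K'.ev p.1.1) = F := by
      funext p
      change _ = (α_ X R R').inv ≫ (p.2 ▷ R ≫ (K p.1.1).ev p.1.2) ▷ R' ≫ K'.ev p.1.1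
      simp
    rw [h]
    exact F.bijective

end MultiHom

/-! ### Internal homs and limits in the completions -/

namespace FinCoprod

variable {C : Type u} [Category.{v} C] [MonoidalCategory C]

/-- A morphism into the formal sum of the `K.obj u` picks, for each summand of its source, one `u`
and a morphism into `K.obj u`. This is exactly the data that `K.curry` extracts. -/
theorem exists_isInternalHom {R S : C} (K : MultiHom R S) :
    ∃ (H : FinCoprod C) (ev : H ⊗ ι R ⟶ ι S), IsInternalHom (ι R) (ι S) H ev := by
  let H : FinCoprod C := ⟨K.index, K.obj⟩
  let ev : H ⊗ ι R ⟶ ι S := ⟨fun _ => PUnit.unit, fun p => K.ev p.1⟩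
  refine ⟨H, ev, fun X h => ?_⟩
  -- Index and component are kept together in one sigma-valued function, so that uniqueness is a
  -- congruence along `curry_ev` and needs no transport between dependent components.
  let mk (L : ∀ x, Σ u, X.obj x ⟶ K.obj u) : X ⟶ H := ⟨fun x => (L x).1, fun x => (L x).2⟩
  refine ⟨mk fun x => K.curry (h.hom (x, PUnit.unit)), ?_, ?_⟩
  · exact Hom.ext' fun p => K.ev_curry (h.hom p)
  · rintro k rfl
    exact congrArg mk (funext fun x => (K.curry_ev (k.idx x) (k.hom x)).symm)

end FinCoprod

namespace FinCoprodProd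

section Limits

variable {C : Type u} [Category.{v} C] {n : ℕ} (A : Fin n → FinCoprodProd C)

/-- The product, given by distributing products over sums. -/
def fan : Fan A :=
  Fan.mk (P := ⟨∀ i, (A i).index, fun f => Σ i, (A i).fiber (f i), fun _ p => (A p.1).obj _ p.2⟩)
    fun i => ⟨fun f => f i, fun _ x => ⟨i, x⟩, fun _ _ => 𝟙 _⟩

def lift {A : Fin n → FinCoprodProd C} {X : FinCoprodProd C} (p : ∀ i, X ⟶ A i) :
    X ⟶ (fan A).pt :=
  ⟨fun w i => (p i).idx w, fun w q => (p q.1).fib w q.2, fun w q => (p q.1).hom w q.2⟩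

def isLimitFan : IsLimit (fan A) :=
  Fan.IsLimit.mk _ (fun s => lift s.proj)
    (fun _ _ => Hom.ext' fun _ _ => Category.comp_id _)
    -- `m` is the lift of its own projections, up to `comp_id` in each component; the projections
    -- may then be rewritten as a whole family.
    (fun _ m h => Eq.trans
      (b := lift fun i => m ≫ (fan A).proj i)
      (Hom.ext' fun _ _ => (Category.comp_id _).symm) (congrArg lift (funext h)))

/-- The coproduct, given by concatenating formal sums. -/
def cofan : Cofan A :=
  Cofan.mk (P := ⟨Σ i, (A i).index, fun p => (A p.1).fiber p.2, fun p => (A p.1).obj p.2⟩)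
    fun i => ⟨fun u => ⟨i, u⟩, fun _ x => x, fun _ _ => 𝟙 _⟩

def desc {A : Fin n → FinCoprodProd C} {X : FinCoprodProd C} (j : ∀ i, A i ⟶ X) :
    (cofan A).pt ⟶ X :=
  ⟨fun p => (j p.1).idx p.2, fun p => (j p.1).fib p.2, fun p => (j p.1).hom p.2⟩

def isColimitCofan : IsColimit (cofan A) :=
  Cofan.IsColimit.mk _ (fun s => desc s.inj)
    (fun _ _ => Hom.ext' fun _ _ => Category.id_comp _)
    (fun _ m h => Eq.trans
      (b := desc fun i => (cofan A).inj i ≫ m)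
      (Hom.ext' fun _ _ => (Category.id_comp _).symm) (congrArg desc (funext h)))

instance hasFiniteProducts : HasFiniteProducts (FinCoprodProd C) :=
  ⟨fun _ => ⟨fun F =>
    have : HasProduct (F.obj ∘ Discrete.mk) := ⟨⟨_, isLimitFan _⟩⟩
    hasLimit_of_iso Discrete.natIsoFunctor.symm⟩⟩

instance hasFiniteCoproducts : HasFiniteCoproducts (FinCoprodProd C) :=
  ⟨fun _ => ⟨fun F =>
    have : HasCoproduct (F.obj ∘ Discrete.mk) := ⟨⟨_, isColimitCofan _⟩⟩
    hasColimit_of_iso Discrete.natIsoFunctor⟩⟩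

end Limits

variable {C : Type u} [Category.{v} C] [MonoidalCategory C]

/-- The internal hom, by distributing `∏_u ∑_v ∏_y ∑_x ∑_k` over the formal products and sums. -/
def internalHom (K : ∀ R S : C, MultiHom R S) (A B : FinCoprodProd C) : FinCoprodProd C where
  index := ∀ u, Σ w, ∀ y : B.fiber w, Σ x, (K (A.obj u x) (B.obj w y)).index
  fiber f := Σ u, B.fiber (f u).1
  obj f p := (K (A.obj p.1 _) (B.obj _ p.2)).obj ((f p.1).2 p.2).2

def internalEv (K : ∀ R S : C, MultiHom R S) (A B : FinCoprodProd C) :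
    internalHom K A B ⊗ A ⟶ B where
  idx p := (p.1 p.2).1
  fib p y := (⟨p.2, y⟩, ((p.1 p.2).2 y).1)
  hom p y := (K (A.obj p.2 _) (B.obj _ y)).ev ((p.1 p.2).2 y).2

/-- Currying acts only on the innermost morphisms. The choices of `v` and `x` are regrouped into the
index of `internalHom`, joined by the index that `K` produces, while the choice in `X.fiber` becomes
the fibre map. -/
theorem isInternalHom_internalEv (K : ∀ R S : C, MultiHom R S) (A B : FinCoprodProd C) :
    IsInternalHom A B (internalHom K A B) (internalEv K A B) := by
  intro X h
  -- The regrouping with `i`, `fx` and `fa` held fixed: only the curried pairs `L` differ between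
  -- the two sides in the proof of uniqueness.
  let mk (i : X.index → A.index → B.index) (fx : ∀ w u, B.fiber (i w u) → X.fiber w)
      (fa : ∀ w u, B.fiber (i w u) → A.fiber u)
      (L : ∀ w u y, Σ k : (K (A.obj u (fa w u y)) (B.obj (i w u) y)).index,
        X.obj w (fx w u y) ⟶ (K (A.obj u (fa w u y)) (B.obj (i w u) y)).obj k) :
      X ⟶ internalHom K A B :=
    ⟨fun w u => ⟨i w u, fun y => ⟨fa w u y, (L w u y).1⟩⟩, fun w p => fx w p.1 p.2,
      fun w p => (L w p.1 p.2).2⟩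
  refine ⟨mk (fun w u => h.idx (w, u)) (fun w u y => (h.fib (w, u) y).1)
    (fun w u y => (h.fib (w, u) y).2) fun w u y => (K _ _).curry (h.hom (w, u) y), ?_, ?_⟩
  · exact Hom.ext' fun p y => (K _ _).ev_curry (h.hom p y)
  · rintro k rfl
    exact congrArg (mk (fun w u => (k.idx w u).1) (fun w u y => k.fib w ⟨u, y⟩)
      fun w u y => ((k.idx w u).2 y).1) (funext fun w => funext fun u => funext fun y =>
        ((K _ _).curry_ev ((k.idx w u).2 y).2 (k.hom w ⟨u, y⟩)).symm)

end FinCoprodProd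

/-- A braided category with all internal homs is closed. -/
theorem nonempty_monoidalClosed {C : Type u} [Category.{v} C] [MonoidalCategory C]
    [BraidedCategory C] (H : C → C → C) (ev : ∀ A B, H A B ⊗ A ⟶ B)
    (hev : ∀ A B, IsInternalHom A B (H A B) (ev A B)) : Nonempty (MonoidalClosed C) := by
  let e (A X B : C) : (X ⟶ H A B) ≃ ((tensorRight A).obj X ⟶ B) :=
    Equiv.ofBijective (fun k => k ▷ A ≫ ev A B)
      ((Function.bijective_iff_existsUnique _).2 (hev A B X))
  -- `MonoidalClosed` asks for a right adjoint of `A ⊗ -`, whereas `hev` yields one of `- ⊗ A`; the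
  -- braiding identifies the two functors.
  refine ⟨⟨fun A => ⟨_, (Adjunction.adjunctionOfEquivRight (F := tensorRight A)
    (fun X B => (e A X B).symm) ?_).ofNatIsoLeft (BraidedCategory.tensorLeftIsoTensorRight A).symm⟩⟩⟩
  intro X' X B f g
  rw [Equiv.symm_apply_eq]
  change f ▷ A ≫ g = (f ≫ (e A X B).symm g) ▷ A ≫ ev A B
  rw [comp_whiskerRight, Category.assoc]
  exact congrArg (f ▷ A ≫ ·) ((e A X B).apply_symm_apply g).symm

/-! ### Trees with one distinguished letter -/

/-- The ranked alphabet with a single letter, of arity `A`. -/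
def RankedAlphabet.single (A : Type) [Fintype A] : RankedAlphabet where
  letters := Unit
  arity _ := A

theorem eq_zero_of_sum_eq_zero {α : Type} [Fintype α] {f : α → ℕ} (h : ∑ i, f i = 0) (i : α) :
    f i = 0 :=
  Finset.sum_eq_zero_iff.1 h i (Finset.mem_univ i)

/-- In a family of natural numbers with sum one, exactly one number is one. -/
theorem exists_eq_one_of_sum_eq_one {α : Type} [Fintype α] {f : α → ℕ} (h : ∑ i, f i = 1) :
    ∃ i, f i = 1 ∧ ∀ j, j ≠ i → f j = 0 := by
  classical
  obtain ⟨i, -, hi⟩ := Finset.exists_ne_zero_of_sum_ne_zero (h.trans_ne one_ne_zero)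
  rw [← Finset.add_sum_erase _ _ (Finset.mem_univ i)] at h
  refine ⟨i, by omega, fun j hj => ?_⟩
  exact Finset.sum_eq_zero_iff.1 (by omega) j (Finset.mem_erase.2 ⟨hj, Finset.mem_univ j⟩)

namespace HoleTree

variable {Γ R : RankedAlphabet} {A B D : Type} [Fintype A]

/-- Renaming holes preserves the shape. This is used to recover a tree with few holes, such as a
stem or a branch, from its copy with all the holes of `s`. -/
theorem graft_hole_injective {f : B → D} (hf : f.Injective) :
    (graft (Γ := Γ) (R := R) fun b => hole (f b)).Injective := by
  intro t
  induction t with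
  | out b c ih =>
    rintro (⟨b', c'⟩ | ⟨r', c'⟩ | x) h
    · simp only [graft, out.injEq] at h
      obtain ⟨rfl, h⟩ := h
      exact congrArg (out b) (funext fun i => ih i (congrFun (eq_of_heq h) i))
    · simp [graft] at h
    · simp [graft] at h
  | reg r c ih =>
    rintro (⟨b', c'⟩ | ⟨r', c'⟩ | x) h
    · simp [graft] at h
    · simp only [graft, reg.injEq] at h
      obtain ⟨rfl, h⟩ := h
      exact congrArg (reg r) (funext fun i => ih i (congrFun (eq_of_heq h) i))
    · simp [graft] at h
  | hole x =>
    rintro (⟨b', c'⟩ | ⟨r', c'⟩ | x) h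
    · simp [graft] at h
    · simp [graft] at h
    · simp only [graft, hole.injEq] at h
      rw [hf h]

theorem countLetter_graft_hole (f : B → D) (r : R.letters) (t : HoleTree Γ R B) :
    (t.graft fun b => hole (f b)).countLetter r = t.countLetter r := by
  induction t with
  | out b c ih => simp only [graft, countLetter, ih]
  | reg r c ih => simp only [graft, countLetter, ih]
  | hole x => rfl

theorem countHole_graft_hole {f : B → D} (hf : f.Injective) (x : B) (t : HoleTree Γ R B) :
    (t.graft fun b => hole (f b)).countHole (f x) = t.countHole x := by
  induction t with
  | out b c ih => simp only [graft, countHole, ih]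
  | reg r c ih => simp only [graft, countHole, ih]
  | hole y => classical exact if_congr hf.eq_iff rfl rfl

theorem countHole_graft_hole_of_notMem {f : B → D} {y : D} (hy : ∀ x, f x ≠ y)
    (t : HoleTree Γ R B) : (t.graft fun b => hole (f b)).countHole y = 0 := by
  induction t with
  | out b c ih => simp only [graft, countHole, ih, Finset.sum_const_zero]
  | reg r c ih => simp only [graft, countHole, ih, Finset.sum_const_zero]
  | hole x => simp only [graft, countHole, hy, if_false]

/-- A tree all of whose holes are in the range of `f` comes from a tree with holes in the domain
of `f`. -/
theorem exists_graft_hole_eq {f : B → D} (t : HoleTree Γ R D)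
    (ht : ∀ y, t.countHole y ≠ 0 → ∃ x, f x = y) : ∃ t', (graft (fun b => hole (f b)) t') = t := by
  induction t with
  | out b c ih =>
    choose t' ht' using fun i => ih i fun y hy =>
      ht y fun h => hy (eq_zero_of_sum_eq_zero h i)
    exact ⟨out b t', congrArg (out b) (funext ht')⟩
  | reg r c ih =>
    choose t' ht' using fun i => ih i fun y hy =>
      ht y fun h => hy (eq_zero_of_sum_eq_zero h i)
    exact ⟨reg r t', congrArg (reg r) (funext ht')⟩
  | hole y =>
    obtain ⟨x, rfl⟩ := ht y (by simp [countHole])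
    exact ⟨hole x, rfl⟩

/-- The inclusion of the trees over `R` into those over `R ⊗ R'`. -/
def inl (R' : RankedAlphabet) (t : HoleTree Γ R B) : HoleTree Γ (R.tensor R') B :=
  t.subst fun r => letter (R := R.tensor R') (.inl r)

theorem inl_out (R' : RankedAlphabet) (b : Γ.letters) (c : Γ.arity b → HoleTree Γ R B) :
    (out b c).inl R' = out b fun i => (c i).inl R' := rfl

theorem inl_reg (R' : RankedAlphabet) (r : R.letters) (c : R.arity r → HoleTree Γ R B) :
    (reg r c).inl R' = reg (R := R.tensor R') (.inl r) fun i => (c i).inl R' := rfl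

theorem countHole_letter (r : R.letters) (x : R.arity r) :
    (letter (Γ := Γ) r).countHole x = 1 :=
  (isLinearOn_reg_hole r (Equiv.refl _) (X := {r}) fun _ => Iff.rfl).2.2 x

theorem countHole_inl (R' : RankedAlphabet) (t : HoleTree Γ R B) (x : B) :
    (t.inl R').countHole x = t.countHole x :=
  countHole_subst _ (fun s => countHole_letter (R := R.tensor R') (.inl s)) t x

theorem countLetter_inl_inl (R' : RankedAlphabet) (t : HoleTree Γ R B) (r : R.letters) :
    (t.inl R').countLetter (R := R.tensor R') (.inl r) = t.countLetter r := by
  induction t with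
  | out b c ih => simp only [inl_out, countLetter, ih]
  | reg r' c ih =>
    have h : (Sum.inl r' : R.letters ⊕ R'.letters) = Sum.inl r ↔ r' = r := Sum.inl_injective.eq_iff
    rw [inl_reg]
    exact congrArg₂ (· + ·) (by classical exact if_congr h rfl rfl) (Finset.sum_congr rfl fun i _ => ih i)
  | hole x => rfl

theorem countLetter_inl_inr (R' : RankedAlphabet) (t : HoleTree Γ R B) (r : R'.letters) :
    (t.inl R').countLetter (R := R.tensor R') (.inr r) = 0 := by
  induction t with
  | out b c ih => simp only [inl_out, countLetter, ih, Finset.sum_const_zero]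
  | reg r' c ih =>
    rw [inl_reg]
    exact congrArg₂ (· + ·) (if_neg Sum.inl_ne_inr)
      (Finset.sum_eq_zero fun i _ => ih i)
  | hole x => rfl

/-- Replacing the subtrees at the distinguished letter by the leaf `none`. -/
def cut : HoleTree Γ (R.tensor (.single A)) B → HoleTree Γ R (Option B)
  | out b c => out b fun i => cut (c i)
  | reg (.inl r) c => reg r fun i => cut (c i)
  | reg (.inr _) _ => hole none
  | hole b => hole (some b)

/-- The immediate subtrees of the nodes with the distinguished letter are the trees `c a`. -/
def HasSubtrees (c : A → HoleTree Γ R B) : HoleTree Γ (R.tensor (.single A)) B → Prop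
  | out _ d => ∀ i, HasSubtrees c (d i)
  | reg (.inl _) d => ∀ i, HasSubtrees c (d i)
  | reg (.inr _) d => ∀ a, d a = (c a).inl (.single A)
  | hole _ => True

/-- Replacing the leaf `none` by a node with the distinguished letter and subtrees `c a`. -/
def plug (t : HoleTree Γ R (Option B)) (c : A → HoleTree Γ R B) :
    HoleTree Γ (R.tensor (.single A)) B :=
  (t.inl (.single A)).graft fun o =>
    o.elim (reg (R := R.tensor (.single A)) (.inr ()) fun a => (c a).inl (.single A)) hole

theorem cut_inl (t : HoleTree Γ R B) :
    (t.inl (.single A)).cut = t.graft fun b => hole (some b) := by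
  induction t with
  | out b c ih => exact congrArg (out b) (funext ih)
  | reg r c ih => exact congrArg (reg r) (funext ih)
  | hole x => rfl

/-- On trees without the distinguished letter `cut` only renames the holes along `some`, and this is
injective. -/
theorem inl_injective : (inl (Γ := Γ) (R := R) (B := B) (.single A)).Injective := fun t t' h =>
  graft_hole_injective (Option.some_injective _) (by rw [← cut_inl (A := A), h, cut_inl])

theorem cut_plug (t : HoleTree Γ R (Option B)) (c : A → HoleTree Γ R B) : (t.plug c).cut = t := by
  induction t with
  | out b c ih => exact congrArg (out b) (funext ih)
  | reg r c ih => exact congrArg (reg r) (funext ih)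
  | hole x => cases x <;> rfl

theorem hasSubtrees_inl (t : HoleTree Γ R B) (c : A → HoleTree Γ R B) :
    HasSubtrees c (t.inl (.single A)) := by
  induction t with
  | out b c ih => exact ih
  | reg r c ih => exact ih
  | hole x => trivial

theorem hasSubtrees_plug (t : HoleTree Γ R (Option B)) (c : A → HoleTree Γ R B) :
    HasSubtrees c (t.plug c) := by
  induction t with
  | out b c ih => exact ih
  | reg r c ih => exact ih
  | hole x =>
    cases x with
    | none => exact fun _ => rfl
    | some x => trivial

/-- With `cut_plug` this makes plugging and cutting mutually inverse for prescribed subtrees. No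
count is required: `HasSubtrees` is vacuous where the letter is absent, and there `plug` inserts
nothing. -/
theorem HasSubtrees.plug_cut {c : A → HoleTree Γ R B} {t : HoleTree Γ (R.tensor (.single A)) B}
    (h : HasSubtrees c t) : t.cut.plug c = t := by
  induction t with
  | out b d ih => exact congrArg (out b) (funext fun i => ih i (h i))
  | reg r d ih =>
    rcases r with r | r
    · exact congrArg (reg (R := R.tensor (.single A)) (.inl r)) (funext fun i => ih i (h i))
    · exact congrArg (reg (R := R.tensor (.single A)) (.inr r)) (funext fun i => (h i).symm)
  | hole x => rfl

theorem countLetter_reg_inl (r : R.letters)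
    (d : R.arity r → HoleTree Γ (R.tensor (.single A)) B) :
    countLetter (R := R.tensor (.single A)) (.inr ()) (reg (R := R.tensor (.single A)) (.inl r) d) =
      ∑ i, countLetter (R := R.tensor (.single A)) (.inr ()) (d i) :=
  (congrArg (· + _) (if_neg Sum.inl_ne_inr)).trans (zero_add _)

theorem countLetter_reg_inr (d : A → HoleTree Γ (R.tensor (.single A)) B) :
    countLetter (R := R.tensor (.single A)) (.inr ())
      (reg (R := R.tensor (.single A)) (.inr ()) d) =
      1 + ∑ i, countLetter (R := R.tensor (.single A)) (.inr ()) (d i) :=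
  congrArg (· + _) (if_pos rfl)

/-- The trees `c a` do not contain the distinguished letter, so its occurrences are never nested and
`cut` turns each of them into one leaf `none`. -/
theorem HasSubtrees.countLetter_eq {c : A → HoleTree Γ R B}
    {t : HoleTree Γ (R.tensor (.single A)) B} (h : HasSubtrees c t) :
    t.countLetter (R := R.tensor (.single A)) (.inr ()) = t.cut.countHole none := by
  induction t with
  | out b d ih => exact Finset.sum_congr rfl fun i _ => ih i (h i)
  | reg r d ih =>
    rcases r with r | r
    · exact (countLetter_reg_inl r d).trans (Finset.sum_congr rfl fun i _ => ih i (h i))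
    · refine (countLetter_reg_inr (A := A) d).trans ((congrArg (1 + ·)
        (Finset.sum_eq_zero fun i _ => ?_)).trans (if_pos rfl).symm)
      rw [h i]
      exact countLetter_inl_inr (.single A) (c i) ()
  | hole x => simp [cut, countLetter, countHole]

/-- The family can be read off at any occurrence of the letter; without an occurrence the condition
is vacuous. -/
theorem HasSubtrees.unique {c c' : A → HoleTree Γ R B}
    {t : HoleTree Γ (R.tensor (.single A)) B} (h : HasSubtrees c t) (h' : HasSubtrees c' t)
    (ht : t.countLetter (R := R.tensor (.single A)) (.inr ()) ≠ 0) : c = c' := by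
  induction t with
  | out b d ih =>
    obtain ⟨i, -, hi⟩ := Finset.exists_ne_zero_of_sum_ne_zero ht
    exact ih i (h i) (h' i) hi
  | reg r d ih =>
    rcases r with r | r
    · obtain ⟨i, -, hi⟩ := Finset.exists_ne_zero_of_sum_ne_zero (countLetter_reg_inl r d ▸ ht)
      exact ih i (h i) (h' i) hi
    · exact funext fun a => inl_injective ((h a).symm.trans (h' a))
  | hole x => exact absurd rfl ht

theorem exists_eq_inl {t : HoleTree Γ (R.tensor (.single A)) B}
    (ht : t.countLetter (R := R.tensor (.single A)) (.inr ()) = 0) :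
    ∃ t', inl (.single A) t' = t := by
  induction t with
  | out b d ih =>
    choose d' hd' using fun i => ih i (eq_zero_of_sum_eq_zero ht i)
    exact ⟨out b d', congrArg (out b) (funext hd')⟩
  | reg r d ih =>
    rcases r with r | r
    · choose d' hd' using fun i : R.arity r =>
        ih i (eq_zero_of_sum_eq_zero ((countLetter_reg_inl r d).symm.trans ht) i)
      exact ⟨reg r d', congrArg (reg (R := R.tensor (.single A)) (.inl r)) (funext hd')⟩
    · have := (countLetter_reg_inr (A := A) d).symm.trans ht
      omega
  | hole x => exact ⟨hole x, rfl⟩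

/-- The induction step common to all nodes other than the distinguished one. Exactly one child
contains the letter and determines `c`; on the other children the condition is vacuous. -/
theorem exists_hasSubtrees_of_sum {α : Type} [Fintype α]
    {d : α → HoleTree Γ (R.tensor (.single A)) B}
    (ih : ∀ i, (d i).countLetter (R := R.tensor (.single A)) (.inr ()) = 1 →
      ∃ c, HasSubtrees c (d i))
    (hd : ∑ i, (d i).countLetter (R := R.tensor (.single A)) (.inr ()) = 1) :
    ∃ c, ∀ i, HasSubtrees c (d i) := by
  obtain ⟨i, hi, hd⟩ := exists_eq_one_of_sum_eq_one hd
  obtain ⟨c, hc⟩ := ih i hi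
  refine ⟨c, fun j => ?_⟩
  obtain rfl | hj := eq_or_ne j i
  · exact hc
  · obtain ⟨t, ht⟩ := exists_eq_inl (hd j hj)
    exact ht ▸ hasSubtrees_inl t c

theorem exists_hasSubtrees {t : HoleTree Γ (R.tensor (.single A)) B}
    (ht : t.countLetter (R := R.tensor (.single A)) (.inr ()) = 1) : ∃ c, HasSubtrees c t := by
  induction t with
  | out b d ih => exact exists_hasSubtrees_of_sum ih ht
  | reg r d ih =>
    rcases r with r | r
    · exact exists_hasSubtrees_of_sum (α := R.arity r) ih ((countLetter_reg_inl r d).symm.trans ht)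
    -- This node uses up the single occurrence, so its subtrees come from trees over `R`.
    · have h := (countLetter_reg_inr (A := A) d).symm.trans ht
      choose c hc using fun i : A => exists_eq_inl (t := d i)
        (eq_zero_of_sum_eq_zero (Nat.add_left_cancel (h.trans (add_zero 1).symm)) i)
      exact ⟨c, fun a => (hc a).symm⟩
  | hole x => exact absurd ht.symm one_ne_zero

/-- Each leaf `none` receives its own copy of the plugged node, hence the factor `t.countHole none`;
it is one for the stems below. -/
theorem countHole_plug [Fintype B] (t : HoleTree Γ R (Option B)) (c : A → HoleTree Γ R B) (b : B) :
    (t.plug c).countHole b =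
      t.countHole (some b) + t.countHole none * ∑ a, (c a).countHole b := by
  rw [plug, countHole_graft, Fintype.sum_option, add_comm, Finset.sum_eq_single b]
  · simp only [countHole_inl, Option.elim, countHole, if_true, mul_one]
    rfl
  · intro b' _ hb
    simp [countHole, hb]
  · simp

theorem countLetter_plug [Fintype B] (t : HoleTree Γ R (Option B)) (c : A → HoleTree Γ R B)
    (r : R.letters) :
    (t.plug c).countLetter (R := R.tensor (.single A)) (.inl r) =
      t.countLetter r + t.countHole none * ∑ a, (c a).countLetter r := by
  refine (countLetter_graft _ _ _).trans (congrArg₂ (· + ·) (countLetter_inl_inl _ _ _) ?_)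
  rw [Fintype.sum_option, countHole_inl, Finset.sum_eq_zero (s := (Finset.univ : Finset B)), add_zero]
  · refine congrArg (t.countHole none * ·) ((congrArg (· + _) (if_neg Sum.inr_ne_inl)).trans
      ((zero_add _).trans (Finset.sum_congr rfl fun a _ => ?_)))
    exact countLetter_inl_inl (.single A) (c a) r
  · intro b _
    simp [countLetter]

end HoleTree

/-! ### Currying a single letter -/

/-- The alphabet obtained from `S` by replacing the letter `s`, into whose tree a letter of arity
`A` is plugged, by a letter for the part of the tree above it and letters for the subtrees `a : A`.
The function `φ` distributes the holes over these parts. -/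
noncomputable def RankedAlphabet.split (S : RankedAlphabet) (A : Type) [Fintype A] (s : S.letters)
    (φ : S.arity s → Option A) : RankedAlphabet where
  letters := {s' // s' ≠ s} ⊕ Option A
  arity := fun
    | .inl s' => S.arity s'
    | .inr none => Option {b // φ b = none}
    | .inr (some a) => {b // φ b = some a}
  fintypeLetters :=
    letI := Classical.decEq S.letters
    inferInstanceAs (Fintype ({s' // s' ≠ s} ⊕ Option A))
  fintypeArity := fun
    | .inl s' => S.fintypeArity s'
    | .inr none => Fintype.ofFinite _
    | .inr (some _) => Fintype.ofFinite _

namespace Register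

variable {Γ R S X : RankedAlphabet} {A : Type} [Fintype A]

/-- The fibres of the partial function are disjoint. Conversely this bound determines a partial
function (`Hom.ofTree`), so the support can be replaced by a count that behaves well when trees are
cut and reassembled. -/
theorem Hom.sum_countLetter_le (f : Hom (Γ := Γ) R S) (r : R.letters) :
    ∑ s, (f.tree s).countLetter r ≤ 1 := by
  cases h : f.support r with
  | none =>
    rw [Finset.sum_eq_zero]
    · exact zero_le_one
    · exact fun s _ => (f.isLinearOn s).2.1 r (by simp [h])
  | some s =>
    rw [Finset.sum_eq_single s]
    · exact ((f.isLinearOn s).1 r h).le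
    · exact fun s' _ hs' => (f.isLinearOn s').2.1 r (by simpa [h] using hs'.symm)
    · simp

open Classical in
/-- The morphism with given trees. -/
noncomputable def Hom.ofTree (w : ∀ s, HoleTree Γ R (S.arity s))
    (hw : ∀ s b, (w s).countHole b = 1) (hw' : ∀ r, ∑ s, (w s).countLetter r ≤ 1) :
    Hom (Γ := Γ) R S where
  support r := if h : ∃ s, (w s).countLetter r = 1 then some h.choose else none
  tree := w
  isLinearOn s := by
    refine ⟨fun r hr => ?_, fun r hr => ?_, hw s⟩
    · simp only [Set.mem_ofPred_eq] at hr
      split at hr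
      · next h => exact Option.some_injective _ hr ▸ h.choose_spec
      · cases hr
    · by_contra hs
      have h1 := Finset.add_sum_erase Finset.univ (fun s => (w s).countLetter r)
        (Finset.mem_univ s)
      have h2 := hw' r
      -- The count at `s` is nonzero and bounded by the total, which is at most one.
      have h : ∃ s, (w s).countLetter r = 1 := ⟨s, by omega⟩
      apply hr
      simp only [Set.mem_ofPred_eq, dif_pos h, Option.some.injEq]
      by_contra hne
      -- If the chosen letter differed from `s`, two trees would contain `r` and the total would be
      -- at least two.
      have h3 := Finset.single_le_sum (f := fun s => (w s).countLetter r)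
        (fun _ _ => Nat.zero_le _) (Finset.mem_erase.2 ⟨hne, Finset.mem_univ h.choose⟩)
      have h4 := h.choose_spec
      omega

/-- The morphism that discards the letter on the right. -/
noncomputable def discard (A : Type) [Fintype A] (k : Hom (Γ := Γ) X S) :
    Hom (Γ := Γ) (X.tensor (.single A)) S :=
  Hom.ofTree (fun s => (k.tree s).inl (.single A))
    (fun s b => (HoleTree.countHole_inl _ _ b).trans ((k.isLinearOn s).2.2 b)) (by
      rintro (r | r)
      · exact (Finset.sum_congr rfl fun s _ => HoleTree.countLetter_inl_inl _ _ _).trans_le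
          (k.sum_countLetter_le r)
      · exact (Finset.sum_eq_zero fun s _ => HoleTree.countLetter_inl_inr _ _ _).trans_le
          zero_le_one)

/-! ### Assembling a morphism from a stem and branches -/

section split

variable {s : S.letters} {φ : S.arity s → Option A}
  (w : ∀ x, HoleTree Γ X ((S.split A s φ).arity x))

/-- The part above the plugged letter, where the leaf `none` stands for that letter. -/
def stem : HoleTree Γ X (Option (S.arity s)) :=
  HoleTree.graft (B := Option {b // φ b = none}) (fun b => .hole (b.map Subtype.val))
    (w (.inr none))

/-- The subtrees of the plugged letter. -/
def branch (a : A) : HoleTree Γ X (S.arity s) :=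
  HoleTree.graft (B := {b // φ b = some a}) (fun b => .hole b.val) (w (.inr (some a)))

open Classical in
/-- Plugging the letter of arity `A` and the subtrees into the part above. -/
noncomputable def assemble (s' : S.letters) :
    HoleTree Γ (X.tensor (.single A)) (S.arity s') :=
  if h : s' = s then h ▸ (stem w).plug (branch w) else (w (.inl ⟨s', h⟩)).inl (.single A)

theorem assemble_self : assemble w s = (stem w).plug (branch w) :=
  dif_pos rfl

theorem assemble_of_ne {s' : S.letters} (h : s' ≠ s) :
    assemble w s' = (w (.inl ⟨s', h⟩)).inl (.single A) :=
  dif_neg h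

theorem map_val_injective {B : Type} (P : B → Prop) :
    (Option.map (Subtype.val : {b // P b} → B)).Injective :=
  Option.map_injective Subtype.val_injective

variable {w}

theorem countHole_stem_none (hw : ∀ x b, (w x).countHole b = 1) :
    (stem w).countHole none = 1 :=
  (HoleTree.countHole_graft_hole (map_val_injective _) none _).trans (hw (.inr none) none)

theorem countHole_stem_some (hw : ∀ x b, (w x).countHole b = 1) (b : S.arity s)
    [Decidable (φ b = none)] :
    (stem w).countHole (some b) = if φ b = none then 1 else 0 := by
  split
  · next h =>
    exact (HoleTree.countHole_graft_hole (map_val_injective _) (some ⟨b, h⟩) _).trans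
      (hw (.inr none) (some ⟨b, h⟩))
  · next h =>
    refine HoleTree.countHole_graft_hole_of_notMem ?_ _
    rintro (_ | ⟨b', hb'⟩) hb
    · cases hb
    · exact h (Option.some_injective _ hb ▸ hb')

theorem countHole_branch (hw : ∀ x b, (w x).countHole b = 1) (a : A) (b : S.arity s)
    [Decidable (φ b = some a)] :
    (branch w a).countHole b = if φ b = some a then 1 else 0 := by
  split
  · next h =>
    exact (HoleTree.countHole_graft_hole Subtype.val_injective ⟨b, h⟩ _).trans
      (hw (.inr (some a)) ⟨b, h⟩)
  · next h =>
    refine HoleTree.countHole_graft_hole_of_notMem ?_ _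
    rintro ⟨b', hb'⟩ rfl
    exact h hb'

/-- A hole `b` of `s` occurs once in the piece named by `φ b` and in no other piece. -/
theorem countHole_assemble (hw : ∀ x b, (w x).countHole b = 1) (s' : S.letters)
    (b : S.arity s') : (assemble w s').countHole b = 1 := by
  classical
  by_cases h : s' = s
  · subst h
    rw [assemble_self, HoleTree.countHole_plug, countHole_stem_none hw, countHole_stem_some hw]
    simp only [countHole_branch hw]
    cases φ b <;> simp
  · rw [assemble_of_ne w h, ← hw (.inl ⟨s', h⟩) b]
    exact HoleTree.countHole_inl (.single A) _ b

theorem countLetter_inr_assemble_self (hw : ∀ x b, (w x).countHole b = 1) :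
    (assemble w s).countLetter (R := X.tensor (.single A)) (.inr ()) = 1 := by
  rw [assemble_self, (HoleTree.hasSubtrees_plug _ _).countLetter_eq, HoleTree.cut_plug,
    countHole_stem_none hw]

theorem countLetter_inr_assemble_of_ne {s' : S.letters} (h : s' ≠ s) :
    (assemble w s').countLetter (R := X.tensor (.single A)) (.inr ()) = 0 := by
  rw [assemble_of_ne w h]
  exact HoleTree.countLetter_inl_inr (.single A) _ ()

/-- Assembly only regroups the pieces: stem and branches, each used once, make up the tree of `s`,
and the other trees are unchanged. The equality transfers the linearity bound from pieces to
assembled trees and back. -/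
theorem sum_countLetter_assemble (hw : ∀ x b, (w x).countHole b = 1) (r : X.letters) :
    ∑ s', (assemble w s').countLetter (R := X.tensor (.single A)) (.inl r) =
      ∑ x, (w x).countLetter r := by
  classical
  rw [Fintype.sum_eq_add_sum_subtype_ne _ s, assemble_self, HoleTree.countLetter_plug,
    countHole_stem_none hw, one_mul]
  refine Eq.trans ?_ (Fintype.sum_sum_type (α₁ := {s' // s' ≠ s}) (α₂ := Option A)
    fun x => (w x).countLetter r).symm
  rw [Fintype.sum_option, add_comm]
  refine congrArg₂ _ (Finset.sum_congr rfl fun s' _ => ?_) (congrArg₂ _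
    (HoleTree.countLetter_graft_hole _ _ _)
    (Finset.sum_congr rfl fun a _ => HoleTree.countLetter_graft_hole _ _ _))
  rw [assemble_of_ne w s'.2]
  exact HoleTree.countLetter_inl_inl _ _ _

/-- The morphism that plugs the letter of arity `A` into the tree of `s`. -/
noncomputable def plugHom (k : Hom (Γ := Γ) X (S.split A s φ)) :
    Hom (Γ := Γ) (X.tensor (.single A)) S :=
  Hom.ofTree (assemble k.tree) (countHole_assemble fun x => (k.isLinearOn x).2.2) (by
    have hk : ∀ x b, (k.tree x).countHole b = 1 := fun x => (k.isLinearOn x).2.2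
    rintro (r | r)
    · exact (sum_countLetter_assemble hk r).trans_le (k.sum_countLetter_le r)
    · refine (Finset.sum_eq_single s (fun s' _ h => countLetter_inr_assemble_of_ne h)
        (by simp)).trans_le (countLetter_inr_assemble_self hk).le)

end split

/-! ### Discarding and plugging as composition with evaluation maps -/

theorem inl_subst_tensor {B : Type} (t : HoleTree Γ S B) (k : Hom (Γ := Γ) X S) :
    (t.inl (.single A)).subst (Hom.tensor k (Hom.id (.single A))).tree =
      (t.subst k.tree).inl (.single A) :=
  (subst_inl _ _).trans (HoleTree.subst_subst _ _ _).symm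

theorem plug_subst_tensor {B : Type} (t : HoleTree Γ S (Option B)) (c : A → HoleTree Γ S B)
    (k : Hom (Γ := Γ) X S) :
    (t.plug c).subst (Hom.tensor k (Hom.id (.single A))).tree =
      (t.subst k.tree).plug fun a => (c a).subst k.tree := by
  refine (HoleTree.graft_subst _ _ _).trans (congrArg₂ (fun t f => HoleTree.graft f t)
    (inl_subst_tensor t k) (funext fun o => ?_))
  cases o with
  | none =>
    exact congrArg (HoleTree.reg (R := X.tensor (.single A)) (.inr ()))
      (funext fun a => inl_subst_tensor (c a) k)
  | some b => rfl

/-- With `tensor_comp_plugHom_id`, this reduces the bijectivity required of a `MultiHom` to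
properties of `discard` and `plugHom`. -/
theorem tensor_comp_discard_id (k : Hom (Γ := Γ) X S) :
    (Hom.tensor k (Hom.id (.single A))).comp (discard A (Hom.id S)) = discard A k :=
  Hom.ext fun s => (inl_subst_tensor _ k).trans
    (congrArg (HoleTree.inl _) (HoleTree.letter_subst _ s))

/-- Assembly commutes with substitution for the letters of `X`. For the identity each piece is a
single letter of the split alphabet, which substitution replaces by the corresponding tree of `k`.
-/
theorem tensor_comp_plugHom_id {s : S.letters} {φ : S.arity s → Option A}
    (k : Hom (Γ := Γ) X (S.split A s φ)) :
    (Hom.tensor k (Hom.id (.single A))).comp (plugHom (Hom.id _)) = plugHom k := by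
  refine Hom.ext fun s' => ?_
  change (assemble (Hom.id (Γ := Γ) (S.split A s φ)).tree s').subst _ = assemble k.tree s'
  by_cases h : s' = s
  · subst h
    rw [assemble_self, assemble_self]
    refine (plug_subst_tensor _ _ k).trans (congrArg₂ HoleTree.plug ?_ (funext fun a => ?_))
    · exact (HoleTree.graft_subst _ _ _).trans
        (congrArg (HoleTree.graft _) (HoleTree.letter_subst k.tree (.inr none)))
    · exact (HoleTree.graft_subst _ _ _).trans
        (congrArg (HoleTree.graft _) (HoleTree.letter_subst k.tree (.inr (some a))))
  · rw [assemble_of_ne _ h, assemble_of_ne _ h]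
    exact (inl_subst_tensor _ k).trans
      (congrArg (HoleTree.inl _) (HoleTree.letter_subst k.tree (.inl ⟨s', h⟩)))

/-! ### Every morphism arises from exactly one discarding or plugging -/

theorem discard_injective : (discard (Γ := Γ) (X := X) (S := S) A).Injective := fun _ _ h =>
  Hom.ext fun s => HoleTree.inl_injective (congrFun (congrArg Hom.tree h) s)

/-- The distinguished letter occurs in the tree of `s` on the right, and in no tree on the left. -/
theorem discard_ne_plugHom {s : S.letters} {φ : S.arity s → Option A} (k : Hom (Γ := Γ) X S)
    (k' : Hom (Γ := Γ) X (S.split A s φ)) : discard A k ≠ plugHom k' := by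
  intro h
  have h1 := countLetter_inr_assemble_self fun x => (k'.isLinearOn x).2.2
  have h2 := HoleTree.countLetter_inl_inr (.single A) (k.tree s) ()
  have h3 : (k.tree s).inl (.single A) = assemble k'.tree s := congrFun (congrArg Hom.tree h) s
  rw [← h3] at h1
  exact zero_ne_one (h2.symm.trans h1)

/-- The trees of `plugHom k` determine the letter `s`, the function `φ` and the trees of `k`. -/
theorem plugHom_injective {s s' : S.letters} {φ : S.arity s → Option A}
    {φ' : S.arity s' → Option A} {k : Hom (Γ := Γ) X (S.split A s φ)}
    {k' : Hom (Γ := Γ) X (S.split A s' φ')} (h : plugHom k = plugHom k') :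
    (⟨⟨s, φ⟩, k⟩ : Σ p : (Σ s, S.arity s → Option A), Hom (Γ := Γ) X (S.split A p.1 p.2)) =
      ⟨⟨s', φ'⟩, k'⟩ := by
  classical
  have hk : ∀ x b, (k.tree x).countHole b = 1 := fun x => (k.isLinearOn x).2.2
  have hk' : ∀ x b, (k'.tree x).countHole b = 1 := fun x => (k'.isLinearOn x).2.2
  have ht : ∀ r, assemble k.tree r = assemble k'.tree r := congrFun (congrArg Hom.tree h)
  have h1 := countLetter_inr_assemble_self hk
  -- `s` is the only letter whose assembled tree contains the distinguished letter.
  obtain rfl : s = s' := by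
    by_contra hne
    rw [ht, countLetter_inr_assemble_of_ne hne] at h1
    exact zero_ne_one h1
  have hp := ht s
  rw [assemble_self, assemble_self] at hp
  -- The stem is recovered by `cut`, the branches as the subtrees at the node, which is present by
  -- `h1`.
  have hs : stem k.tree = stem k'.tree := by
    rw [← HoleTree.cut_plug (stem k.tree) (branch k.tree), hp, HoleTree.cut_plug]
  have hb : branch k.tree = branch k'.tree := by
    refine (HoleTree.hasSubtrees_plug (stem k.tree) _).unique
      (hp ▸ HoleTree.hasSubtrees_plug (stem k'.tree) _) ?_
    rw [← assemble_self, h1]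
    exact one_ne_zero
  -- The hole counts of stem and branches are the indicator functions of the fibres of `φ`.
  obtain rfl : φ = φ' := by
    funext b
    cases hφ : φ b with
    | none =>
      have h2 := countHole_stem_some hk b
      rw [hs, countHole_stem_some hk' b, if_pos hφ] at h2
      by_contra hne
      rw [if_neg (Ne.symm hne)] at h2
      exact zero_ne_one h2
    | some a =>
      have h2 := countHole_branch hk a b
      rw [hb, countHole_branch hk' a b, if_pos hφ] at h2
      by_contra hne
      rw [if_neg (Ne.symm hne)] at h2
      exact zero_ne_one h2
  have : k = k' := by
    refine Hom.ext ?_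
    rintro (⟨r, hr⟩ | _ | a)
    · have h2 := ht r
      rw [assemble_of_ne _ hr, assemble_of_ne _ hr] at h2
      exact HoleTree.inl_injective h2
    · exact HoleTree.graft_hole_injective (map_val_injective _) hs
    · exact HoleTree.graft_hole_injective Subtype.val_injective (congrFun hb a)
  rw [this]

/-- The dichotomy is whether the support of `h` is defined at the distinguished letter. If it is,
with value `s`, the tree of `s` is cut there and `φ` records the piece in which each hole lies. -/
theorem exists_discard_or_plugHom (h : Hom (Γ := Γ) (X.tensor (.single A)) S) :
    (∃ k, discard A k = h) ∨
      ∃ (s : S.letters) (φ : S.arity s → Option A) (k : Hom (Γ := Γ) X (S.split A s φ)),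
        plugHom k = h := by
  cases hs : h.support (.inr ()) with
  | none =>
    left
    choose w hw using fun s => HoleTree.exists_eq_inl ((h.isLinearOn s).2.1 (.inr ())
      fun hr =>
      absurd (hs.symm.trans hr) (Option.some_ne_none s).symm)
    refine ⟨Hom.ofTree w (fun s b => ?_) (fun r => ?_), Hom.ext hw⟩
    · rw [← (h.isLinearOn s).2.2 b, ← hw, HoleTree.countHole_inl]
    · refine (Finset.sum_congr rfl fun s _ => ?_).trans_le (h.sum_countLetter_le (.inl r))
      rw [← hw]
      exact (HoleTree.countLetter_inl_inl _ _ _).symm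
  | some s =>
    right
    have h1 := (h.isLinearOn s).1 (.inr ()) hs
    obtain ⟨c, hc⟩ := HoleTree.exists_hasSubtrees h1
    have hn : (h.tree s).cut.countHole none = 1 := hc.countLetter_eq.symm.trans h1
    -- Linearity of the uncut tree: the occurrences of `b` in the stem (`none`) and in the branches
    -- (`some a`) add up to one. Hence exactly one piece contains `b`, and `φ b` is that piece.
    have hcount : ∀ b, ∑ o : Option A,
        o.elim ((h.tree s).cut.countHole (some b)) (fun a => (c a).countHole b) = 1 := by
      intro b
      rw [Fintype.sum_option, ← (h.isLinearOn s).2.2 b]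
      conv_rhs => rw [← hc.plug_cut, HoleTree.countHole_plug, hn, one_mul]
      rfl
    choose φ hφ hφ' using fun b => exists_eq_one_of_sum_eq_one (hcount b)
    -- Stem and branches contain only the holes that `φ` assigns to them, so they are trees with the
    -- smaller hole sets prescribed by `split`.
    obtain ⟨t, ht⟩ := HoleTree.exists_graft_hole_eq
      (f := Option.map (Subtype.val : {b // φ b = none} → S.arity s)) (h.tree s).cut (by
        rintro (_ | b) hb
        · exact ⟨none, rfl⟩
        · refine ⟨some ⟨b, ?_⟩, rfl⟩
          by_contra hne
          exact hb (hφ' b none (Ne.symm hne)))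
    choose d hd using fun a => HoleTree.exists_graft_hole_eq
      (f := (Subtype.val : {b // φ b = some a} → S.arity s)) (c a) (by
        intro b hb
        refine ⟨⟨b, ?_⟩, rfl⟩
        by_contra hne
        exact hb (hφ' b (some a) (Ne.symm hne)))
    choose e he using fun s' : {s' // s' ≠ s} => HoleTree.exists_eq_inl
      ((h.isLinearOn s').2.1 (.inr ())
      fun hr => s'.2 (Option.some_injective _ (hr.symm.trans hs)))
    let w : ∀ x, HoleTree Γ X ((S.split A s φ).arity x) := fun x => match x with
      | .inl s' => e s'
      | .inr none => t
      | .inr (some a) => d a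
    have hw : ∀ x b, (w x).countHole b = 1 := by
      rintro (s' | _ | a) b
      · rw [← (h.isLinearOn s').2.2 b, ← he]
        exact (HoleTree.countHole_inl _ _ _).symm
      · refine (HoleTree.countHole_graft_hole (map_val_injective _) b t).symm.trans ?_
        rw [ht]
        cases b with
        | none => exact hn
        | some b =>
          have := hφ b.1
          rwa [b.2] at this
      · refine (HoleTree.countHole_graft_hole Subtype.val_injective b (d a)).symm.trans ?_
        rw [hd]
        have := hφ b.1
        rwa [b.2] at this
    have hh : assemble w = h.tree := by
      funext s'
      by_cases hs' : s' = s
      · subst hs'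
        rw [assemble_self, ← hc.plug_cut]
        exact congrArg₂ HoleTree.plug ht (funext hd)
      · rw [assemble_of_ne w hs']
        exact he ⟨s', hs'⟩
    refine ⟨s, φ, Hom.ofTree w hw fun r => ?_, Hom.ext (congrFun hh)⟩
    rw [← sum_countLetter_assemble hw, hh]
    exact h.sum_countLetter_le _

/-- The family of internal homs out of an alphabet with a single letter. -/
noncomputable def multiHomSingle (A : Type) [Fintype A] (S : RankedAlphabet) :
    MultiHom (C := Register Γ) (RankedAlphabet.single A) S where
  index := Option (Σ s : S.letters, S.arity s → Option A)
  obj u := u.elim S fun p => S.split A p.1 p.2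
  ev u := match u with
    | none => discard A (Hom.id S)
    | some _ => plugHom (Hom.id _)
  bijective X := by
    constructor
    · rintro ⟨_ | ⟨s, φ⟩, k⟩ ⟨_ | ⟨s', φ'⟩, k'⟩ h
      · have h' := ((tensor_comp_discard_id k).symm.trans h).trans (tensor_comp_discard_id k')
        rw [discard_injective h']
      · exact absurd (((tensor_comp_discard_id k).symm.trans h).trans (tensor_comp_plugHom_id k'))
          (discard_ne_plugHom k k')
      · exact absurd (((tensor_comp_discard_id k').symm.trans h.symm).trans
          (tensor_comp_plugHom_id k)) (discard_ne_plugHom k' k)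
      · have h' := ((tensor_comp_plugHom_id k).symm.trans h).trans (tensor_comp_plugHom_id k')
        have := plugHom_injective h'
        cases this
        rfl
    · intro h
      obtain ⟨k, rfl⟩ | ⟨s, φ, k, rfl⟩ := exists_discard_or_plugHom h
      · exact ⟨⟨none, k⟩, tensor_comp_discard_id k⟩
      · exact ⟨⟨some ⟨s, φ⟩, k⟩, tensor_comp_plugHom_id k⟩

/-! ### Currying an arbitrary alphabet, by induction on the letters -/

/-- An isomorphism of registers given by bijections between letters and between arities. -/
def relabelIso {α β : Type} [Fintype α] [Fintype β] (e : α ≃ β) (ar : β → Type)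
    [∀ b, Fintype (ar b)] :
    Iso (C := Register Γ) (RankedAlphabet.mk α fun a => ar (e a)) (RankedAlphabet.mk β ar) where
  hom := relabel (R := RankedAlphabet.mk α fun a => ar (e a)) (S := RankedAlphabet.mk β ar) e.symm
    fun b => Equiv.cast (congrArg ar (e.apply_symm_apply b))
  inv := relabel (R := RankedAlphabet.mk β ar) (S := RankedAlphabet.mk α fun a => ar (e a)) e
    fun _ => Equiv.refl _
  hom_inv_id := Hom.ext fun a => by
    -- `e.symm (e a) = a` is not definitional, so the letter is generalised to `a'`; the cast on
    -- holes disappears once `h` is substituted.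
    have (a' : α) (h : a' = a) : (HoleTree.reg (R := .mk α fun a => ar (e a)) a' fun b =>
        .hole (cast (congrArg (fun a => ar (e a)) h) b) : HoleTree Γ _ (ar (e a))) =
        HoleTree.letter (R := .mk α fun a => ar (e a)) a := by
      subst h
      rfl
    exact this _ (e.symm_apply_apply a)
  inv_hom_id := Hom.ext fun b => by
    have (b' : β) (h : b' = b) : (HoleTree.reg (R := .mk β ar) b' fun x =>
        .hole (cast (congrArg ar h) x) : HoleTree Γ _ (ar b)) =
        HoleTree.letter (R := .mk β ar) b := by
      subst h
      rfl
    exact this _ (e.apply_symm_apply b)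

/-- Splitting off one letter. -/
def optionIso {α : Type} [Fintype α] [Fintype (Option α)] (ar : Option α → Type) [∀ a, Fintype (ar a)] :
    Iso (C := Register Γ)
      (RankedAlphabet.tensor (.mk α fun a => ar (some a)) (.single (ar none)))
      (RankedAlphabet.mk (Option α) ar) where
  hom := relabel (S := RankedAlphabet.mk (Option α) ar)
    (R := RankedAlphabet.tensor (.mk α fun a => ar (some a)) (.single (ar none)))
    (Equiv.optionEquivSumPUnit α) fun s => match s with
    | none => Equiv.refl _
    | some _ => Equiv.refl _
  inv := relabel (R := RankedAlphabet.mk (Option α) ar)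
    (S := RankedAlphabet.tensor (.mk α fun a => ar (some a)) (.single (ar none)))
    (Equiv.optionEquivSumPUnit α).symm fun s => match s with
    | .inl _ => Equiv.refl _
    | .inr _ => Equiv.refl _
  hom_inv_id := Hom.ext (by rintro (s | s) <;> rfl)
  inv_hom_id := Hom.ext (by rintro (_ | s) <;> rfl)

/-- The unit is an alphabet indexed by the empty type. -/
def emptyIso [Fintype PEmpty.{1}] (ar : PEmpty.{1} → Type) [∀ a, Fintype (ar a)] :
    Iso (C := Register Γ) RankedAlphabet.empty (RankedAlphabet.mk PEmpty ar) where
  hom := relabel (R := .empty) (S := .mk PEmpty ar) (Equiv.equivOfIsEmpty PEmpty Empty) fun s => s.elim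
  inv := relabel (R := .mk PEmpty ar) (S := .empty) (Equiv.equivOfIsEmpty Empty PEmpty) fun s => s.elim
  hom_inv_id := Hom.ext fun s => s.elim
  inv_hom_id := Hom.ext fun s => s.elim

/-- Induction on the finite type of letters. The target `S` is quantified inside the statement
because, once one letter is curried, the induction hypothesis is needed for each of the resulting
targets. `Nonempty` makes the statement a proposition, as the induction principle requires. -/
theorem nonempty_multiHom_mk (α : Type) [Fintype α] (ar : α → Type) [∀ a, Fintype (ar a)] :
    Nonempty (∀ S, MultiHom (C := Register Γ) (RankedAlphabet.mk α ar) S) := by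
  suffices h : ∀ [Fintype α] (ar : α → Type) [∀ a, Fintype (ar a)],
      Nonempty (∀ S, MultiHom (C := Register Γ) (RankedAlphabet.mk α ar) S) from h ar
  refine Finite.induction_empty_option (P := fun α => ∀ [Fintype α] (ar : α → Type)
    [∀ a, Fintype (ar a)], Nonempty (∀ S, MultiHom (C := Register Γ) (RankedAlphabet.mk α ar) S))
    ?_ ?_ ?_ α
  · intro α β e h _ ar _
    let _ := Fintype.ofEquiv β e.symm
    exact (h fun a => ar (e a)).map fun K S => (K S).ofIso (relabelIso e ar)
  · intro _ ar _
    exact ⟨fun S => (MultiHom.ofUnit S).ofIso (emptyIso ar)⟩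
  · intro α _ h _ ar _
    exact (h fun a => ar (some a)).map fun K S =>
      ((multiHomSingle (ar none) S).ofTensor fun _ => K _).ofIso (optionIso ar)

theorem nonempty_multiHom (R : RankedAlphabet) :
    Nonempty (∀ S, MultiHom (C := Register Γ) R S) :=
  nonempty_multiHom_mk R.letters R.arity

end Register

theorem mainTheorem8 (Γ : RankedAlphabet) :
    (∀ R S : Register Γ, ∃ (H : FinCoprod (Register Γ)) (ev : H ⊗ FinCoprod.ι R ⟶ FinCoprod.ι S),
      IsInternalHom (FinCoprod.ι R) (FinCoprod.ι S) H ev) ∧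
    HasFiniteProducts (FinCoprodProd (Register Γ)) ∧
    HasFiniteCoproducts (FinCoprodProd (Register Γ)) ∧
    (∀ A B : FinCoprodProd (Register Γ), (β_ A B).hom ≫ (β_ B A).hom = 𝟙 (A ⊗ B)) ∧
    Nonempty (MonoidalClosed (FinCoprodProd (Register Γ))) := by
  let K (R S : Register Γ) : MultiHom R S := (Register.nonempty_multiHom R).some S
  refine ⟨fun R S => FinCoprod.exists_isInternalHom (K R S), inferInstance, inferInstance,
    fun A B => ?_, nonempty_monoidalClosed _ _ (FinCoprodProd.isInternalHom_internalEv K)⟩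
  -- Swapping index pairs twice is the identity by definition; what remains is that, over each
  -- letter, the two swaps in `Register Γ` compose to the identity tree.
  exact FinCoprodProd.Hom.ext' fun p q => Register.Hom.ext (by rintro (s | s) <;> rfl)
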